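/- Let $q\in\mathbb{C}$ with $0<|q|<1$. Let $\mathcal{O}(U_q(2))$ be the unital complex $*$-algebra generated by $a,b,D$ with the relations $$ba=q\,ab,\quad a^*b=q\,ba^*,\quad bb^*=b^*b,\quad aa^*+bb^*=1,\quad a^*a+|q|^2b^*b=1,$$ $$aD=Da,\quad bD=q^2|q|^{-2}Db,\quad DD^*=D^*D=1,$$ and with the comultiplication $\Delta$, the $*$-homomorphism $\mathcal{O}(U_q(2))\to\mathcal{O}(U_q(2))\otimes\mathcal{O}(U_q(2))$ given by $$\Delta(a)=a\otimes a-\bar q\,b\otimes Db^*,\quad \Delta(b)=a\otimes b+b\otimes Da^*,\quad \Delta(D)=D\otimes D.$$ Put $c=-\bar q\,Db^*$. For a scalar $Q$ put $(\alpha;Q)_n=\prod_{r=0}^{n-1}(1-\alpha Q^r)$, $\binom{n}{m}_Q=\frac{(Q;Q)_n}{(Q;Q)_m(Q;Q)_{n-m}}$ and let $$\mathcal{P}_n^{(\alpha,\beta)}(z;Q)=\sum_{r=0}^{n}\frac{(Q^{-n};Q)_r\,(Q^{\alpha+\beta+n+1};Q)_r}{(Q;Q)_r\,(Q^{\alpha+1};Q)_r}(Qz)^r$$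 be the little $Q$-Jacobi polynomials. For $l\in\frac12\mathbb{N}$ let $I_l=\{-l,-l+1,\dots,l\}$ and, for $j\in I_l$, $f_j^l=\binom{2l}{l+j}_{|q|^2}^{1/2}a^{l-j}b^{l+j}$. Then there are unique elements $t^l_{ij}\in\mathcal{O}(U_q(2))$, $i,j\in I_l$, with $\Delta(f_j^l)=\sum_{i\in I_l}f_i^l\otimes t_{ij}^l$ for all $j\in I_l$, and for all $i,j\in I_l$ and $k\in\mathbb{Z}$ the matrix coefficient $t^l_{ij}D^k$ is equal to (i) if $i+j\le 0$ and $i\ge j$: $$a^{-(i+j)}c^{i-j}\,\bar q^{(j-i)(l+j)}\frac{\binom{2l}{l+j}_{|q|^2}^{1/2}}{\binom{2l}{l+i}_{|q|^2}^{1/2}}\binom{l-j}{i-j}_{|q|^2}\mathcal{P}_{l+j}^{(i-j,-i-j)}(bb^*;|q|^2)\,D^{l+j+k};$$ (ii) if $i+j\le 0$ and $i\le j$: $$a^{-(i+j)}b^{j-i}\,q^{(i-j)(l+i)}\frac{\binom{2l}{l+j}_{|q|^2}^{1/2}}{\binom{2l}{l+i}_{|q|^2}^{1/2}}\binom{l+j}{j-i}_{|q|^2}\mathcal{P}_{l+i}^{(j-i,-i-j)}(bb^*;|q|^2)\,D^{l+i+k};$$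 (iii) if $i+j\ge 0$ and $i\le j$: $$q^{(i-j)(l+i)}\frac{\binom{2l}{l+j}_{|q|^2}^{1/2}}{\binom{2l}{l+i}_{|q|^2}^{1/2}}\binom{l+j}{j-i}_{|q|^2}\mathcal{P}_{l-j}^{(j-i,i+j)}(bb^*;|q|^2)\,(a^*)^{i+j}b^{j-i}\,D^{l+i+k};$$ (iv) if $i+j\ge 0$ and $i\ge j$: $$\bar q^{(j-i)(l+j)}\frac{\binom{2l}{l+j}_{|q|^2}^{1/2}}{\binom{2l}{l+i}_{|q|^2}^{1/2}}\binom{l-j}{i-j}_{|q|^2}\mathcal{P}_{l-i}^{(i-j,i+j)}(bb^*;|q|^2)\,(a^*)^{i+j}c^{i-j}\,D^{l+j+k}.$$ -/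

import Mathlib

open scoped TensorProduct ComplexConjugate

namespace Uq2

/-! ### Scalars: `q`-Pochhammer symbols, `q`-binomials, little `q`-Jacobi polynomials -/

section Scalars

variable {K : Type*} [Field K]

/-- `(α; Q)_n = ∏_{r=0}^{n-1} (1 - α Q^r)`. -/
def qPoch (α Q : K) (n : ℕ) : K := ∏ r ∈ Finset.range n, (1 - α * Q ^ r)

/-- The `Q`-binomial coefficient `(Q;Q)_n / ((Q;Q)_m (Q;Q)_{n-m})`, for `m ≤ n`. -/
def qBinom (Q : K) (n m : ℕ) : K := qPoch Q Q n / (qPoch Q Q m * qPoch Q Q (n - m))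

/-- The little `Q`-Jacobi polynomial `P_n^{(α,β)}(z; Q)`, with integer parameters.
The defining series stops at `r = n`, because `(Q^{-n}; Q)_r = 0` for `r > n`. -/
noncomputable def littleJacobi (n : ℕ) (α β : ℤ) (Q : K) : Polynomial K :=
  ∑ r ∈ Finset.range (n + 1),
    Polynomial.C ((qPoch (Q ^ (-(n : ℤ))) Q r * qPoch (Q ^ (α + β + n + 1)) Q r) /
      (qPoch Q Q r * qPoch (Q ^ (α + 1)) Q r)) * (Polynomial.C Q * Polynomial.X) ^ r

end Scalars

/-! ### The `*`-algebra `O(U_q(2))` -/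

/-- The defining relations of `U_q(2)` for a triple `(a, b, D)` in a unital `*`-algebra. -/
structure Relations (q : ℂ) {B : Type*} [Ring B] [StarRing B] [Algebra ℂ B]
    (a b D : B) : Prop where
  ba : b * a = q • (a * b)
  asb : star a * b = q • (b * star a)
  bbs : b * star b = star b * b
  aas : a * star a + b * star b = 1
  aD : a * D = D * a
  bD : b * D = (q ^ 2 * ((‖q‖ ^ 2 : ℝ) : ℂ)⁻¹) • (D * b)
  DDs : D * star D = 1
  DsD : star D * D = 1
  asa : star a * a + ((‖q‖ ^ 2 : ℝ) : ℂ) • (star b * b) = 1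

/-- The letters `a, a*, b, b*, D, D*`. -/
inductive Letter
  | a | as | b | bs | D | Ds

/-- The formal adjoint of a letter. -/
def Letter.adj : Letter → Letter
  | .a => .as | .as => .a | .b => .bs | .bs => .b | .D => .Ds | .Ds => .D

/-- The letters, as elements of the free algebra. -/
noncomputable def gen (x : Letter) : FreeAlgebra ℂ Letter := FreeAlgebra.ι ℂ x

/-- The defining relations of `U_q(2)` together with their formal adjoints. -/
inductive Rel (q : ℂ) : FreeAlgebra ℂ Letter → FreeAlgebra ℂ Letter → Prop
  | ba : Rel q (gen .b * gen .a) (q • (gen .a * gen .b))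
  | ba_adj : Rel q (gen .as * gen .bs) (conj q • (gen .bs * gen .as))
  | asb : Rel q (gen .as * gen .b) (q • (gen .b * gen .as))
  | asb_adj : Rel q (gen .bs * gen .a) (conj q • (gen .a * gen .bs))
  | bbs : Rel q (gen .b * gen .bs) (gen .bs * gen .b)
  | aas : Rel q (gen .a * gen .as + gen .b * gen .bs) 1
  | aD : Rel q (gen .a * gen .D) (gen .D * gen .a)
  | aD_adj : Rel q (gen .Ds * gen .as) (gen .as * gen .Ds)
  | bD : Rel q (gen .b * gen .D)
      ((q ^ 2 * ((‖q‖ ^ 2 : ℝ) : ℂ)⁻¹) • (gen .D * gen .b))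
  | bD_adj : Rel q (gen .Ds * gen .bs)
      ((conj q ^ 2 * ((‖q‖ ^ 2 : ℝ) : ℂ)⁻¹) • (gen .bs * gen .Ds))
  | DDs : Rel q (gen .D * gen .Ds) 1
  | DsD : Rel q (gen .Ds * gen .D) 1
  | asa : Rel q (gen .as * gen .a + ((‖q‖ ^ 2 : ℝ) : ℂ) • (gen .bs * gen .b)) 1

/-- `O(U_q(2))`: the unital complex `*`-algebra generated by `a, b, D` subject to the defining
relations of `U_q(2)`. -/
def O (q : ℂ) : Type := RingQuot (Rel q)

noncomputable instance (q : ℂ) : Ring (O q) := inferInstanceAs (Ring (RingQuot (Rel q)))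

noncomputable instance (q : ℂ) : Algebra ℂ (O q) :=
  inferInstanceAs (Algebra ℂ (RingQuot (Rel q)))

namespace O

/-- The quotient map from the free algebra. -/
noncomputable def mk (q : ℂ) : FreeAlgebra ℂ Letter →ₐ[ℂ] O q := RingQuot.mkAlgHom ℂ (Rel q)

theorem mk_rel {q : ℂ} {x y : FreeAlgebra ℂ Letter} (h : Rel q x y) : mk q x = mk q y :=
  RingQuot.mkAlgHom_rel ℂ h

/-- The image of a letter in `O(U_q(2))`. -/
noncomputable def letter (q : ℂ) (x : Letter) : O q := mk q (gen x)

/-- An algebra homomorphism out of `O(U_q(2))` from images of the six letters. -/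
noncomputable def liftAlg {q : ℂ} {B : Type*} [Ring B] [Algebra ℂ B] (f : Letter → B)
    (h : ∀ ⦃x y⦄, Rel q x y → FreeAlgebra.lift ℂ f x = FreeAlgebra.lift ℂ f y) : O q →ₐ[ℂ] B :=
  RingQuot.liftAlgHom ℂ ⟨FreeAlgebra.lift ℂ f, h⟩

theorem liftAlg_letter {q : ℂ} {B : Type*} [Ring B] [Algebra ℂ B] (f : Letter → B)
    (h : ∀ ⦃x y⦄, Rel q x y → FreeAlgebra.lift ℂ f x = FreeAlgebra.lift ℂ f y) (x : Letter) :
    liftAlg f h (letter q x) = f x := by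
  have := RingQuot.liftAlgHom_mkAlgHom_apply ℂ (FreeAlgebra.lift ℂ f) h (gen x)
  refine this.trans ?_
  simp [gen]

theorem algHom_ext {q : ℂ} {B : Type*} [Ring B] [Algebra ℂ B] {f g : O q →ₐ[ℂ] B}
    (h : ∀ x, f (letter q x) = g (letter q x)) : f = g := by
  apply RingQuot.ringQuot_ext'
  apply FreeAlgebra.hom_ext
  funext x
  exact h x

/-- The opposite algebra with conjugate scalars, used to build the adjoint. -/
def ConjOp (B : Type*) : Type _ := Bᵐᵒᵖ

instance (B : Type*) [Ring B] : Ring (ConjOp B) := inferInstanceAs (Ring Bᵐᵒᵖ)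

noncomputable instance (B : Type*) [Ring B] [Algebra ℂ B] : Algebra ℂ (ConjOp B) :=
  RingHom.toAlgebra' (S := Bᵐᵒᵖ) ((algebraMap ℂ Bᵐᵒᵖ).comp (starRingEnd ℂ))
    fun c x => Algebra.commutes (conj c) x

/-- The conjugate-linear anti-isomorphism `ConjOp B → B`. -/
def ConjOp.out {B : Type*} [Ring B] : ConjOp B ≃+ B := MulOpposite.opAddEquiv.symm

section out

variable {B : Type*} [Ring B]

theorem ConjOp.out_mul (x y : ConjOp B) : (x * y).out = y.out * x.out := rfl

theorem ConjOp.out_one : (1 : ConjOp B).out = 1 := rfl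

theorem ConjOp.out_smul [Algebra ℂ B] (c : ℂ) (x : ConjOp B) :
    (c • x).out = conj c • x.out := by
  rw [Algebra.smul_def, Algebra.smul_def, Algebra.commutes (conj c)]
  rfl

end out

/-- The adjoint of `O(U_q(2))`, as a homomorphism to the conjugate opposite algebra. -/
noncomputable def adjHom (q : ℂ) : O q →ₐ[ℂ] ConjOp (O q) :=
  liftAlg (fun x => ConjOp.out.symm (letter q x.adj)) (by
    intro x y h
    apply ConjOp.out.injective
    cases h <;>
    simp only [map_mul, map_add, map_one, map_smul, gen, FreeAlgebra.lift_ι_apply,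
      ConjOp.out_mul, ConjOp.out_one, ConjOp.out_smul, AddEquiv.apply_symm_apply, Letter.adj,
      Complex.conj_conj, Complex.conj_ofReal, map_pow, map_inv₀]
    · simpa [letter] using mk_rel (Rel.ba_adj (q := q))
    · simpa [letter] using mk_rel (Rel.ba (q := q))
    · simpa [letter] using mk_rel (Rel.asb_adj (q := q))
    · simpa [letter] using mk_rel (Rel.asb (q := q))
    · simpa [letter] using mk_rel (Rel.bbs (q := q))
    · simpa [letter] using mk_rel (Rel.aas (q := q))
    · simpa [letter] using mk_rel (Rel.aD_adj (q := q))
    · simpa [letter] using mk_rel (Rel.aD (q := q))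
    · simpa [letter] using mk_rel (Rel.bD_adj (q := q))
    · simpa [letter] using mk_rel (Rel.bD (q := q))
    · simpa [letter] using mk_rel (Rel.DDs (q := q))
    · simpa [letter] using mk_rel (Rel.DsD (q := q))
    · simpa [letter] using mk_rel (Rel.asa (q := q)))

theorem adjHom_letter (q : ℂ) (x : Letter) :
    (adjHom q (letter q x)).out = letter q x.adj := by
  rw [adjHom, liftAlg_letter, AddEquiv.apply_symm_apply]

@[elab_as_elim]
theorem induction {q : ℂ} {p : O q → Prop} (scalar : ∀ c, p (algebraMap ℂ _ c))
    (let_ : ∀ x, p (letter q x)) (mul : ∀ x y, p x → p y → p (x * y))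
    (add : ∀ x y, p x → p y → p (x + y)) (x : O q) : p x := by
  obtain ⟨y, rfl⟩ := RingQuot.mkAlgHom_surjective ℂ (Rel q) x
  change p (mk q y)
  induction y using FreeAlgebra.induction with
  | grade0 r => simpa using scalar r
  | grade1 x => exact let_ x
  | mul x y hx hy => simpa using mul _ _ hx hy
  | add x y hx hy => simpa using add _ _ hx hy

theorem out_adjHom_algebraMap (q c : ℂ) :
    (adjHom q (algebraMap ℂ _ c)).out = algebraMap ℂ _ (conj c) := by
  rw [AlgHom.commutes]
  rfl

/-- The adjoint is the conjugate-linear anti-automorphism exchanging `a, b, D` with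
`a*, b*, D*`. -/
noncomputable instance (q : ℂ) : StarRing (O q) where
  star x := (adjHom q x).out
  star_involutive x := by
    change (adjHom q (adjHom q x).out).out = x
    induction x using induction with
    | scalar c => rw [out_adjHom_algebraMap, out_adjHom_algebraMap, Complex.conj_conj]
    | let_ x => rw [adjHom_letter, adjHom_letter]; cases x <;> rfl
    | mul x y hx hy => rw [map_mul, ConjOp.out_mul, map_mul, ConjOp.out_mul, hx, hy]
    | add x y hx hy => rw [map_add, map_add, map_add, map_add, hx, hy]
  star_mul x y := by
    change (adjHom q (x * y)).out = (adjHom q y).out * (adjHom q x).out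
    rw [map_mul, ConjOp.out_mul]
  star_add x y := by
    change (adjHom q (x + y)).out = (adjHom q x).out + (adjHom q y).out
    rw [map_add, map_add]

theorem star_letter (q : ℂ) (x : Letter) : star (letter q x) = letter q x.adj :=
  adjHom_letter q x

instance (q : ℂ) : StarModule ℂ (O q) where
  star_smul c x := by
    change (adjHom q (c • x)).out = conj c • (adjHom q x).out
    rw [map_smul, ConjOp.out_smul]

/-- The generator `a`. -/
noncomputable def a (q : ℂ) : O q := letter q .a

/-- The generator `b`. -/
noncomputable def b (q : ℂ) : O q := letter q .b

/-- The generator `D`. -/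
noncomputable def D (q : ℂ) : O q := letter q .D

theorem star_a (q : ℂ) : star (a q) = letter q .as := star_letter q .a

theorem star_b (q : ℂ) : star (b q) = letter q .bs := star_letter q .b

theorem star_D (q : ℂ) : star (D q) = letter q .Ds := star_letter q .D

theorem relations (q : ℂ) : Relations q (a q) (b q) (D q) where
  ba := by simpa [a, b, letter] using mk_rel (Rel.ba (q := q))
  asb := by rw [star_a]; simpa [b, letter] using mk_rel (Rel.asb (q := q))
  bbs := by rw [star_b]; simpa [b, letter] using mk_rel (Rel.bbs (q := q))
  aas := by rw [star_a, star_b]; simpa [a, b, letter] using mk_rel (Rel.aas (q := q))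
  aD := by simpa [a, D, letter] using mk_rel (Rel.aD (q := q))
  bD := by simpa [b, D, letter] using mk_rel (Rel.bD (q := q))
  DDs := by rw [star_D]; simpa [D, letter] using mk_rel (Rel.DDs (q := q))
  DsD := by rw [star_D]; simpa [D, letter] using mk_rel (Rel.DsD (q := q))
  asa := by rw [star_a, star_b]; simpa [a, b, letter] using mk_rel (Rel.asa (q := q))

/-- The values on the six letters determined by a triple. -/
def letterVal {B : Type*} [Star B] (a' b' D' : B) : Letter → B
  | .a => a' | .as => star a' | .b => b' | .bs => star b' | .D => D' | .Ds => star D'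

section Lift

variable {q : ℂ} {B : Type*} [Ring B] [StarRing B] [Algebra ℂ B] [StarModule ℂ B]
  {a' b' D' : B}

/-- The universal property: a triple satisfying the defining relations in a `*`-algebra gives a
`*`-homomorphism. -/
noncomputable def lift (h : Relations q a' b' D') : O q →⋆ₐ[ℂ] B :=
  let φ : O q →ₐ[ℂ] B := liftAlg (letterVal a' b' D') (by
    intro x y r
    cases r <;>
    simp only [map_mul, map_add, map_one, map_smul, gen, FreeAlgebra.lift_ι_apply, letterVal]
    · exact h.ba
    · simpa using congrArg star h.ba
    · exact h.asb
    · simpa using congrArg star h.asb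
    · exact h.bbs
    · exact h.aas
    · exact h.aD
    · simpa using congrArg star h.aD
    · exact h.bD
    · simpa using congrArg star h.bD
    · exact h.DDs
    · exact h.DsD
    · exact h.asa)
  { φ with
    map_star' := fun x => by
      change φ (star x) = star (φ x)
      induction x using induction with
      | scalar c => rw [← algebraMap_star_comm, AlgHom.commutes, AlgHom.commutes,
          algebraMap_star_comm]
      | let_ x => rw [star_letter, liftAlg_letter, liftAlg_letter]; cases x <;>
          simp [letterVal, Letter.adj]
      | mul x y hx hy => rw [star_mul, map_mul, map_mul, star_mul, hx, hy]
      | add x y hx hy => rw [star_add, map_add, map_add, star_add, hx, hy] }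

theorem lift_a (h : Relations q a' b' D') : lift h (a q) = a' := liftAlg_letter _ _ _

theorem lift_b (h : Relations q a' b' D') : lift h (b q) = b' := liftAlg_letter _ _ _

theorem lift_D (h : Relations q a' b' D') : lift h (D q) = D' := liftAlg_letter _ _ _

end Lift

end O

/-! ### The comultiplication -/

section Comul

theorem mul_assoc_rule {B : Type*} [Ring B] {x y z : B} (h : x * y = z) (w : B) :
    x * (y * w) = z * w := by
  rw [← mul_assoc, h]

variable {q : ℂ} {B : Type*} [Ring B] [StarRing B] [Algebra ℂ B] [StarModule ℂ B]

theorem normSq_eq (q : ℂ) : ((‖q‖ ^ 2 : ℝ) : ℂ) = q * conj q := by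
  rw [Complex.mul_conj, Complex.normSq_eq_norm_sq]

/-- Rules that bring a word in `a, a*, b, b*, D, D*` to the order `D, D*, a, a*, b, b*`. -/
theorem Relations.rules {a b D : B} (h : Relations q a b D) (hq : q ≠ 0) :
    b * a = q • (a * b) ∧ b * star a = q⁻¹ • (star a * b) ∧
    star b * a = conj q • (a * star b) ∧ star b * star a = (conj q)⁻¹ • (star a * star b) ∧
    star b * b = b * star b ∧ a * star a = 1 - b * star b ∧
    star a * a = 1 - (q * conj q) • (b * star b) ∧
    a * D = D * a ∧ star a * D = D * star a ∧ a * star D = star D * a ∧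
    star a * star D = star D * star a ∧
    b * D = (q / conj q) • (D * b) ∧ star b * D = (conj q / q) • (D * star b) ∧
    b * star D = (conj q / q) • (star D * b) ∧
    star b * star D = (q / conj q) • (star D * star b) ∧
    D * star D = 1 ∧ star D * D = 1 := by
  have hc : conj q ≠ 0 := by simpa using hq
  have hp : q ^ 2 * ((‖q‖ ^ 2 : ℝ) : ℂ)⁻¹ = q / conj q := by
    rw [normSq_eq]; field_simp
  have bD := h.bD
  rw [hp] at bD
  have e1 : ∀ x y : B, x * D = y → x = y * star D := by
    rintro x y rfl; rw [mul_assoc, h.DDs, mul_one]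
  have e2 : ∀ x y : B, D * x = y → x = star D * y := by
    rintro x y rfl; rw [← mul_assoc, h.DsD, one_mul]
  have aDs : a * star D = star D * a := by
    apply e2
    rw [← mul_assoc, ← h.aD, mul_assoc, h.DDs, mul_one]
  have bDs : b * star D = (conj q / q) • (star D * b) := by
    rw [← mul_smul_comm]
    apply e2
    have : D * b = (conj q / q) • (b * D) := by
      rw [bD, smul_smul]
      have : conj q / q * (q / conj q) = 1 := by field_simp
      rw [this, one_smul]
    rw [← mul_assoc, this, smul_mul_assoc, mul_assoc, h.DDs, mul_one]
  have hc' : star (conj q) = q := Complex.conj_conj q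
  have hc2 : star q = conj q := rfl
  refine ⟨h.ba, ?_, ?_, ?_, h.bbs.symm, ?_, ?_, h.aD, ?_, aDs, ?_, bD, ?_, bDs, ?_, h.DDs, h.DsD⟩
  · rw [h.asb, smul_smul, inv_mul_cancel₀ hq, one_smul]
  · simpa using congrArg star h.asb
  · have := congrArg star h.ba
    simp only [star_mul, star_smul, hc2] at this
    rw [this, smul_smul, inv_mul_cancel₀ hc, one_smul]
  · rw [← h.aas, add_sub_cancel_right]
  · rw [← h.asa, normSq_eq, h.bbs, add_sub_cancel_right]
  · simpa using (congrArg star aDs).symm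
  · simpa using (congrArg star h.aD).symm
  · have := congrArg star bDs
    simp only [star_mul, star_star, star_smul, star_div₀, hc', hc2] at this
    rw [this, smul_smul]
    have : conj q / q * (q / conj q) = 1 := by field_simp
    rw [this, one_smul]
  · have := congrArg star bD
    simp only [star_mul, star_smul, star_div₀, hc', hc2] at this
    rw [this, smul_smul]
    have : q / conj q * (conj q / q) = 1 := by field_simp
    rw [this, one_smul]

theorem comul_relations (hq : q ≠ 0) :
    Relations q
      (O.a q ⊗ₜ[ℂ] O.a q - conj q • (O.b q ⊗ₜ[ℂ] (O.D q * star (O.b q))))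
      (O.a q ⊗ₜ[ℂ] O.b q + O.b q ⊗ₜ[ℂ] (O.D q * star (O.a q)))
      (O.D q ⊗ₜ[ℂ] O.D q) := by
  have hc : conj q ≠ 0 := by simpa using hq
  have hc' : star (conj q) = q := Complex.conj_conj q
  have hp : q ^ 2 * ((‖q‖ ^ 2 : ℝ) : ℂ)⁻¹ = q / conj q := by
    rw [normSq_eq]; field_simp
  obtain ⟨r1, r2, r3, r4, r5, r6, r7, r8, r9, r10, r11, r12, r13, r14, r15, r16, r17⟩ :=
    (O.relations q).rules hq
  have s8 := mul_assoc_rule r8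
  have s9 := mul_assoc_rule r9
  have s10 := mul_assoc_rule r10
  have s11 := mul_assoc_rule r11
  have s12 := mul_assoc_rule r12
  have s13 := mul_assoc_rule r13
  have s14 := mul_assoc_rule r14
  have s15 := mul_assoc_rule r15
  have s16 := mul_assoc_rule r16
  have s17 := mul_assoc_rule r17
  constructor
  all_goals
    try rw [hp]
    try rw [normSq_eq]
    simp only [star_sub, star_add, star_smul, TensorProduct.star_tmul, star_mul, star_star, hc',
      mul_add, add_mul, mul_sub, sub_mul, smul_mul_assoc, mul_smul_comm,
      Algebra.TensorProduct.tmul_mul_tmul, mul_assoc, mul_one, one_mul,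
      r1, r2, r3, r4, r5, r6, r7, r8, r9, r10, r12, r13, r14, r16, r17,
      s8, s9, s10, s11, s12, s13, s14, s15, s16, s17,
      TensorProduct.tmul_sub,
      TensorProduct.sub_tmul, TensorProduct.tmul_smul, ← TensorProduct.smul_tmul',
      smul_smul, smul_add, smul_sub, Algebra.TensorProduct.one_def]
    try match_scalars <;> field_simp <;> ring

/-- The comultiplication of `O(U_q(2))`, the `*`-homomorphism with
`Δ(a) = a ⊗ a - q̄ b ⊗ D b*`, `Δ(b) = a ⊗ b + b ⊗ D a*`, `Δ(D) = D ⊗ D`. -/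
noncomputable def comul (hq : q ≠ 0) : O q →⋆ₐ[ℂ] O q ⊗[ℂ] O q :=
  O.lift (comul_relations hq)

end Comul

/-! ### Matrix coefficients

A half-integer `l ≥ 0` is represented by `L = 2l : ℕ`, and `i ∈ I_l = {-l, -l+1, …, l}` by the
natural number `l + i ∈ {0, …, L}`, an element of `Fin (L + 1)`. -/

/-- The element `i = (l + i) - l` of `I_l` represented by `l + i : Fin (L + 1)`. -/
def wt {L : ℕ} (i : Fin (L + 1)) : ℚ := (i : ℚ) - (L : ℚ) / 2

/-- The unitary `D` as a unit, so that `D ^ k` makes sense for `k : ℤ`; its inverse is `D*`. -/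
noncomputable def unitD (q : ℂ) : (O q)ˣ where
  val := O.D q
  inv := star (O.D q)
  val_inv := (O.relations q).DDs
  inv_val := (O.relations q).DsD

/-- `D ^ k`, for `k : ℤ`. -/
noncomputable def Dpow (q : ℂ) (k : ℤ) : O q := ((unitD q ^ k : (O q)ˣ) : O q)

/-- `c = -q̄ D b*`. -/
noncomputable def c (q : ℂ) : O q := -(conj q • (O.D q * star (O.b q)))

/-- `f_j^l = binom(2l, l+j)_{|q|²}^{1/2} a^{l-j} b^{l+j}`, the basis vectors of the comodule
`V_l^R`. -/
noncomputable def f (q : ℂ) (L : ℕ) (j : Fin (L + 1)) : O q :=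
  ((Real.sqrt (qBinom (‖q‖ ^ 2) L j) : ℝ) : ℂ) • (O.a q ^ (L - (j : ℕ)) * O.b q ^ (j : ℕ))

/-- `t` is the matrix of the corepresentation `T_l^R = Δ|V_l^R` in the basis `(f_j^l)`:
`Δ(f_j^l) = ∑_i f_i^l ⊗ t_{ij}^l` for all `j ∈ I_l`. -/
def IsMatrixCoeff {q : ℂ} (hq : q ≠ 0) (L : ℕ)
    (t : Matrix (Fin (L + 1)) (Fin (L + 1)) (O q)) : Prop :=
  ∀ j, comul hq (f q L j) = ∑ i, f q L i ⊗ₜ[ℂ] t i j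

/-- `binom(2l, l+j)_{|q|²}^{1/2} / binom(2l, l+i)_{|q|²}^{1/2}`. -/
noncomputable def ratio (q : ℂ) (L : ℕ) (i j : Fin (L + 1)) : ℂ :=
  ((Real.sqrt (qBinom (‖q‖ ^ 2) L j) / Real.sqrt (qBinom (‖q‖ ^ 2) L i) : ℝ) : ℂ)

/-- `binom(n, m)_{|q|²}` as a complex number. -/
noncomputable def binomC (q : ℂ) (n m : ℕ) : ℂ := ((qBinom (‖q‖ ^ 2) n m : ℝ) : ℂ)

/-- `P_n^{(α,β)}(b b*; |q|²)`, an element of `O(U_q(2))`. -/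
noncomputable def jacobi (q : ℂ) (n : ℕ) (α β : ℤ) : O q :=
  Polynomial.aeval (O.b q * star (O.b q)) (littleJacobi n α β ((‖q‖ ^ 2 : ℝ) : ℂ))

end Uq2

/-! Put `d = D a*`, `z = b b*`, `Q = q q̄ = |q|²`. Since `Δ` is multiplicative, `Δ(a^N b^j) = (a⊗a +
b⊗c)^N (a⊗b + b⊗d)^j`. Because `ba = q ab`, the first tensor legs can be ordered as `a^(N+j-i) b^i`;
the second leg belonging to index `i` is `coeff q N j i`, and the matrix entry is this element (with
`N = L - j`) times a ratio of normalising square roots.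

The coefficients are found by induction on `j`. While `i ≤ N` there is still an `a` to meet each new
`a*`, and `a a* = 1 - z` produces a Pascal rule in two binomials (`coeff_eq_sum_of_le`). For `i ≥ N`
the `a*` accumulate and a single Pascal rule suffices, starting from the diagonal `i = N`
(`coeff_eq_sum_of_ge`). Both give sums of words `c^m b^(j-k) D^k` with `m + k = i`.

In such a word the pairs `c b` collapse to scalar multiples of `z D`, which leaves `z^s` times one
excess power of `b` (for `i ≤ j`) or of `c` (for `i ≥ j`). All phases `q̄/q` cancel, and the scalar
of `z^s` is a little Jacobi coefficient times a factor independent of `s`. The two alternatives for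
`i`, `N` and the two for `i`, `j` yield the four cases, `coeff_of_add_le_of_le` to
`coeff_of_le_add_of_ge`.

Uniqueness is linear independence of the monomials `a^(L-i) b^i`, seen in the representation `rep`,
where `a` is a shift and `b` is diagonal (`eq_of_sum_tmul_eq`). -/

namespace Uq2

/-! ### Gaussian binomials and the coefficients of little Jacobi polynomials -/

section Gauss

variable {K : Type*} [Field K]

/-- The Gaussian binomial coefficient, defined by the Pascal recursion; it vanishes for `n < k`. -/
def gauss (Q : K) : ℕ → ℕ → K
  | _, 0 => 1
  | 0, _ + 1 => 0
  | n + 1, k + 1 => gauss Q n k + Q ^ (k + 1) * gauss Q n (k + 1)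

/-- `gauss Q n (k - 1)`, with value `0` at `k = 0`. -/
def gaussPred (Q : K) (n : ℕ) : ℕ → K
  | 0 => 0
  | k + 1 => gauss Q n k

@[simp] theorem gauss_zero_right (Q : K) (n : ℕ) : gauss Q n 0 = 1 := by cases n <;> rfl

@[simp] theorem gauss_zero_succ (Q : K) (k : ℕ) : gauss Q 0 (k + 1) = 0 := rfl

theorem gauss_succ_succ (Q : K) (n k : ℕ) :
    gauss Q (n + 1) (k + 1) = gauss Q n k + Q ^ (k + 1) * gauss Q n (k + 1) := rfl

theorem gauss_succ (Q : K) (n k : ℕ) :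
    gauss Q (n + 1) k = gaussPred Q n k + Q ^ k * gauss Q n k := by
  cases k
  · simp [gaussPred]
  · rfl

theorem gauss_eq_zero (Q : K) {n k : ℕ} (h : n < k) : gauss Q n k = 0 := by
  induction n generalizing k with
  | zero => obtain ⟨k, rfl⟩ := Nat.exists_eq_succ_of_ne_zero h.ne'; rfl
  | succ n ih =>
    obtain ⟨k, rfl⟩ := Nat.exists_eq_succ_of_ne_zero (Nat.ne_of_gt (Nat.zero_lt_of_lt h))
    rw [Nat.succ_eq_add_one, gauss_succ_succ, ih (by omega), ih (by omega)]
    simp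

@[simp] theorem gauss_self (Q : K) (n : ℕ) : gauss Q n n = 1 := by
  induction n with
  | zero => rfl
  | succ n ih => rw [gauss_succ_succ, ih, gauss_eq_zero Q (Nat.lt_succ_self n)]; simp

@[simp] theorem qPoch_zero (x Q : K) : qPoch x Q 0 = 1 := by simp [qPoch]

theorem qPoch_succ (x Q : K) (n : ℕ) : qPoch x Q (n + 1) = qPoch x Q n * (1 - x * Q ^ n) := by
  simp [qPoch, Finset.prod_range_succ]

theorem qPoch_add (Q : K) (n s : ℕ) :
    qPoch Q Q (n + s) = qPoch Q Q n * qPoch (Q ^ (n + 1)) Q s := by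
  rw [qPoch, Finset.prod_range_add]
  simp only [qPoch, ← pow_succ', ← pow_add]
  congr 1
  refine Finset.prod_congr rfl fun r _ => ?_
  rw [add_right_comm]

/-- The factorial formula in division-free form, so that it holds for every `Q`. Double induction:
Pascal combines the cases `(n + 1, k)` and `(n, k + 1)`. -/
theorem gauss_mul_qPoch (Q : K) (n k : ℕ) :
    gauss Q (n + k) k * (qPoch Q Q k * qPoch Q Q n) = qPoch Q Q (n + k) := by
  induction k generalizing n with
  | zero => simp
  | succ k ihk =>
    induction n with
    | zero => simp
    | succ n ihn =>
      have e1 := ihk (n + 1)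
      have e2 : n + 1 + k = n + (k + 1) := by omega
      rw [e2] at e1
      rw [show n + 1 + (k + 1) = n + (k + 1) + 1 by omega, gauss_succ_succ, qPoch_succ Q Q k,
        qPoch_succ Q Q (n + (k + 1))]
      rw [qPoch_succ Q Q k] at ihn
      rw [qPoch_succ Q Q n] at e1 ⊢
      have e3 : Q * Q ^ (n + (k + 1)) = Q ^ (k + 1) * (Q * Q ^ n) := by ring
      rw [e3, pow_succ' Q k]
      rw [pow_succ' Q k] at e3
      linear_combination (1 - Q * Q ^ k) * e1 + Q * Q ^ k * (1 - Q * Q ^ n) * ihn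

variable {Q : K}

theorem qPoch_pow_ne_zero (hQ : ∀ r : ℕ, Q ^ (r + 1) ≠ 1) (n s : ℕ) :
    qPoch (Q ^ (n + 1)) Q s ≠ 0 := by
  refine Finset.prod_ne_zero_iff.2 fun r _ => sub_ne_zero.2 ?_
  rw [← pow_add, add_right_comm]
  exact (hQ _).symm

theorem qPoch_self_ne_zero (hQ : ∀ r : ℕ, Q ^ (r + 1) ≠ 1) (s : ℕ) : qPoch Q Q s ≠ 0 := by
  simpa using qPoch_pow_ne_zero hQ 0 s

theorem gauss_eq_div (hQ : ∀ r : ℕ, Q ^ (r + 1) ≠ 1) (n k : ℕ) :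
    gauss Q (n + k) k = qPoch Q Q (n + k) / (qPoch Q Q k * qPoch Q Q n) := by
  rw [eq_div_iff (mul_ne_zero (qPoch_self_ne_zero hQ _) (qPoch_self_ne_zero hQ _)),
    gauss_mul_qPoch]

theorem qBinom_eq_gauss (hQ : ∀ r : ℕ, Q ^ (r + 1) ≠ 1) {n k : ℕ} (h : k ≤ n) :
    qBinom Q n k = gauss Q n k := by
  obtain ⟨m, rfl⟩ := Nat.exists_eq_add_of_le' h
  rw [gauss_eq_div hQ, qBinom, Nat.add_sub_cancel]

theorem gauss_symm (hQ : ∀ r : ℕ, Q ^ (r + 1) ≠ 1) (n k : ℕ) :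
    gauss Q (n + k) k = gauss Q (n + k) n := by
  rw [gauss_eq_div hQ, add_comm n k, gauss_eq_div hQ, mul_comm]

/-- Both sides equal `(Q;Q)_{N+s} / ((Q;Q)_α (Q;Q)_{N-α})`. This moves the dependence on `s` into
the shifted factorials of a Jacobi coefficient. -/
theorem gauss_add_mul_qPoch (hQ : ∀ r : ℕ, Q ^ (r + 1) ≠ 1) {N α : ℕ} (h : α ≤ N) (s : ℕ) :
    gauss Q (N + s) (α + s) * qPoch (Q ^ (α + 1)) Q s =
      gauss Q N α * qPoch (Q ^ (N + 1)) Q s := by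
  obtain ⟨n, rfl⟩ := Nat.exists_eq_add_of_le' h
  rw [add_assoc, gauss_eq_div hQ, gauss_eq_div hQ, ← add_assoc, qPoch_add Q α s,
    qPoch_add Q (n + α) s]
  have h1 := qPoch_self_ne_zero hQ α
  have h2 := qPoch_self_ne_zero hQ n
  have h3 := qPoch_pow_ne_zero hQ α s
  field_simp

/-- The same extraction for a product of two binomials: with `n = t + s` fixed, what remains of `s`
on the right is `gauss Q n s` and one shifted factorial, as in `jacobiCoeff`. -/
theorem gauss_mul_gauss_mul_qPoch (hQ : ∀ r : ℕ, Q ^ (r + 1) ≠ 1) (t α M s : ℕ) :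
    gauss Q (t + s + α) (α + s) * gauss Q (M + s) s * qPoch (Q ^ (α + 1)) Q s =
      gauss Q (t + s + α) α * gauss Q (t + s) s * qPoch (Q ^ (M + 1)) Q s := by
  rw [show gauss Q (t + s + α) (α + s) = gauss Q (t + (α + s)) (α + s) by congr 1; omega,
    gauss_eq_div hQ, gauss_eq_div hQ, gauss_eq_div hQ, gauss_eq_div hQ, qPoch_add Q α s,
    qPoch_add Q M s, show t + (α + s) = t + s + α by omega]
  have h1 := qPoch_self_ne_zero hQ α
  have h2 := qPoch_self_ne_zero hQ t
  have h3 := qPoch_pow_ne_zero hQ α s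
  have h4 := qPoch_self_ne_zero hQ s
  have h5 := qPoch_self_ne_zero hQ M
  have h6 := qPoch_self_ne_zero hQ (t + s)
  field_simp

/-- Two factorisations of the `Q`-trinomial coefficient of `(p, k, m)`. It makes the two formulas
for `coeff` agree at `i = N`. -/
theorem gauss_mul_gauss_comm (hQ : ∀ r : ℕ, Q ^ (r + 1) ≠ 1) (m k p : ℕ) :
    gauss Q (p + k) k * gauss Q (p + k + m) m = gauss Q (m + k) m * gauss Q (p + k + m) (m + k) := by
  rw [gauss_symm hQ p k, show gauss Q (p + k + m) (m + k) = gauss Q (p + (m + k)) (m + k) by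
      congr 1; omega, add_comm p k, add_comm m k, gauss_eq_div hQ, gauss_eq_div hQ, gauss_eq_div hQ,
    gauss_eq_div hQ, show p + (k + m) = k + p + m by omega]
  have h1 := qPoch_self_ne_zero hQ p
  have h2 := qPoch_self_ne_zero hQ k
  have h3 := qPoch_self_ne_zero hQ m
  have h4 := qPoch_self_ne_zero hQ (k + p)
  have h5 := qPoch_self_ne_zero hQ (k + m)
  field_simp

/-- Multiply out `1 - Q^(r-n) = -Q^(r-n) (1 - Q^(n-r))` over `r < s`; the exponents `r` add up to
`s.choose 2`. -/
theorem qPoch_zpow_neg (hQ0 : Q ≠ 0) {n s : ℕ} (h : s ≤ n) :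
    qPoch (Q ^ (-(n : ℤ))) Q s * Q ^ (n * s) * qPoch Q Q (n - s) =
      (-1) ^ s * Q ^ s.choose 2 * qPoch Q Q n := by
  induction s with
  | zero => simp
  | succ s ih =>
    obtain ⟨m, rfl⟩ := Nat.exists_eq_add_of_le' h
    have ih := ih (by omega)
    rw [show m + (s + 1) - s = m + 1 by omega, qPoch_succ Q Q m] at ih
    rw [Nat.add_sub_cancel, qPoch_succ, Nat.choose_succ_succ' s 1, Nat.choose_one_right,
      pow_add Q s]
    have e : Q ^ (-((m + (s + 1) : ℕ) : ℤ)) = (Q ^ (m + (s + 1)))⁻¹ := by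
      rw [zpow_neg, zpow_natCast]
    rw [e] at ih ⊢
    have h3 : (1 - (Q ^ (m + (s + 1)))⁻¹ * Q ^ s) * Q ^ (m + (s + 1)) =
        - Q ^ s * (1 - Q * Q ^ m) := by
      field_simp
      ring
    rw [mul_add, mul_one, pow_add Q (_ * s)]
    linear_combination (-(Q ^ s)) * ih +
      qPoch (Q ^ (m + (s + 1)))⁻¹ Q s * Q ^ ((m + (s + 1)) * s) * qPoch Q Q m * h3

/-- The coefficients of the little `Q`-Jacobi polynomial with parameters in `ℕ`. -/
def jacobiCoeff (Q : K) (n α β s : ℕ) : K :=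
  (-1) ^ s * Q ^ (s + s.choose 2) * (Q ^ (n * s))⁻¹ * gauss Q n s *
    qPoch (Q ^ (α + β + n + 1)) Q s / qPoch (Q ^ (α + 1)) Q s

theorem littleJacobi_eq_sum (hQ0 : Q ≠ 0) (hQ : ∀ r : ℕ, Q ^ (r + 1) ≠ 1) (n α β : ℕ) :
    littleJacobi n α β Q =
      ∑ s ∈ Finset.range (n + 1), Polynomial.C (jacobiCoeff Q n α β s) * Polynomial.X ^ s := by
  refine Finset.sum_congr rfl fun s hs => ?_
  have hs : s ≤ n := Nat.lt_succ_iff.1 (Finset.mem_range.1 hs)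
  rw [mul_pow, ← mul_assoc, ← Polynomial.C_pow, ← Polynomial.C_mul]
  congr 2
  have h0 := qPoch_zpow_neg hQ0 hs
  obtain ⟨t, rfl⟩ := Nat.exists_eq_add_of_le' hs
  rw [Nat.add_sub_cancel] at h0
  rw [jacobiCoeff, gauss_eq_div hQ]
  have e1 : Q ^ ((α : ℤ) + 1) = Q ^ (α + 1) := by norm_cast
  have e2 : Q ^ ((α : ℤ) + β + (t + s : ℕ) + 1) = Q ^ (α + β + (t + s) + 1) := by norm_cast
  rw [e1, e2]
  have h1 := qPoch_self_ne_zero hQ s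
  have h2 := qPoch_self_ne_zero hQ t
  have h3 := qPoch_pow_ne_zero hQ α s
  have h4 : Q ^ ((t + s) * s) ≠ 0 := pow_ne_zero _ hQ0
  generalize qPoch (Q ^ (α + β + (t + s) + 1)) Q s = X
  generalize qPoch (Q ^ (α + 1)) Q s = Z at *
  generalize Q ^ ((t + s) * s) = Y at *
  rw [pow_add]
  field_simp
  linear_combination X * h0

end Gauss

/-! ### A representation separating the monomials `a^(L-i) b^i` -/

/-- The action of the letters on functions on `ℕ × ℤ`. -/
noncomputable def repLetter (q : ℂ) : Letter → Module.End ℂ (ℕ → ℤ → ℂ)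
  | .a =>
    { toFun := fun ψ k m => match k with | 0 => 0 | k + 1 => ψ k m
      map_add' := fun x y => by funext k m; cases k <;> simp
      map_smul' := fun x y => by funext k m; cases k <;> simp }
  | .as =>
    { toFun := fun ψ k m => (1 - (q * conj q) ^ (k + 1)) * ψ (k + 1) m
      map_add' := fun x y => by funext k m; simp [mul_add]
      map_smul' := fun x y => by funext k m; simp [mul_left_comm] }
  | .b =>
    { toFun := fun ψ k m => q ^ k * (q / conj q) ^ m * ψ k m
      map_add' := fun x y => by funext k m; simp [mul_add]
      map_smul' := fun x y => by funext k m; simp [mul_left_comm] }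
  | .bs =>
    { toFun := fun ψ k m => conj q ^ k * ((q / conj q) ^ m)⁻¹ * ψ k m
      map_add' := fun x y => by funext k m; simp [mul_add]
      map_smul' := fun x y => by funext k m; simp [mul_left_comm] }
  | .D =>
    { toFun := fun ψ k m => ψ k (m - 1)
      map_add' := fun x y => rfl
      map_smul' := fun x y => rfl }
  | .Ds =>
    { toFun := fun ψ k m => ψ k (m + 1)
      map_add' := fun x y => rfl
      map_smul' := fun x y => rfl }

variable {q : ℂ}

/-- A representation of `O(U_q(2))` on functions on `ℕ × ℤ`. -/
noncomputable def rep (hq : q ≠ 0) : O q →ₐ[ℂ] Module.End ℂ (ℕ → ℤ → ℂ) :=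
  O.liftAlg (repLetter q) (by
    have hc : conj q ≠ 0 := by simpa using hq
    have hθ : q / conj q ≠ 0 := div_ne_zero hq hc
    intro x y h
    cases h <;>
    simp only [map_mul, map_add, map_one, map_smul, gen, FreeAlgebra.lift_ι_apply, normSq_eq] <;>
    refine LinearMap.ext fun ψ => funext fun k => funext fun m => ?_
    -- The shift `a` puts the value `0` at `k = 0`, so relations involving it need a separate check
    -- there.
    all_goals try cases k
    all_goals
      simp only [repLetter, Module.End.mul_apply, LinearMap.add_apply, LinearMap.smul_apply,
        Module.End.one_apply, LinearMap.coe_mk, AddHom.coe_mk, Pi.add_apply, Pi.smul_apply,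
        smul_eq_mul, sub_add_cancel, add_sub_cancel_right, zpow_add₀ hθ, zpow_sub₀ hθ, zpow_one]
    all_goals
      generalize hT : (q / conj q) ^ m = T
      have hT0 : T ≠ 0 := hT ▸ zpow_ne_zero m hθ
      try field_simp
      try ring)

/-- On functions supported at `k = 0`, `b` only multiplies by the phase `(q/q̄)^m`, which is `1` at
`m = 0`; then `a^n` shifts the support to `k = n`. -/
theorem rep_a_pow_mul_b_pow (hq : q ≠ 0) (n p k : ℕ) :
    rep hq (O.a q ^ n * O.b q ^ p) (fun k _ => if k = 0 then 1 else 0) k 0 =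
      if k = n then 1 else 0 := by
  have hb : ∀ p : ℕ, rep hq (O.b q ^ p) (fun k _ => if k = 0 then 1 else 0) =
      fun k m => if k = 0 then ((q / conj q) ^ m) ^ p else 0 := by
    intro p
    induction p with
    | zero => simp
    | succ p ih =>
      rw [pow_succ', map_mul, Module.End.mul_apply, ih]
      funext k m
      rw [O.b, rep, O.liftAlg_letter]
      by_cases h : k = 0 <;> simp [repLetter, h, pow_succ']
  induction n generalizing k with
  | zero => rw [pow_zero, one_mul, hb]; simp
  | succ n ih =>
    rw [pow_succ', mul_assoc, map_mul, Module.End.mul_apply]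
    have ha : ∀ ψ : ℕ → ℤ → ℂ, rep hq (O.a q) ψ k 0 = repLetter q .a ψ k 0 := by
      intro ψ
      rw [O.a, rep, O.liftAlg_letter]
    rw [ha]
    cases k with
    | zero => simp [repLetter]
    | succ k => simpa [repLetter] using ih k

/-- A linear functional that separates the monomials `a ^ (L - i) * b ^ i`. -/
noncomputable def coord (hq : q ≠ 0) (n : ℕ) : O q →ₗ[ℂ] ℂ :=
  (LinearMap.proj (R := ℂ) (φ := fun _ : ℤ => ℂ) 0 ∘ₗ
    LinearMap.proj (R := ℂ) (φ := fun _ : ℕ => ℤ → ℂ) n ∘ₗ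
    LinearMap.applyₗ (R := ℂ) (fun (k : ℕ) (_ : ℤ) => if k = 0 then (1 : ℂ) else 0)) ∘ₗ
    (rep hq).toLinearMap

theorem coord_a_pow_mul_b_pow (hq : q ≠ 0) (n p k : ℕ) :
    coord hq k (O.a q ^ n * O.b q ^ p) = if k = n then 1 else 0 :=
  rep_a_pow_mul_b_pow hq n p k

/-- Applying `coord` at `L - i` to the first leg isolates the `i`-th second leg, since the exponents
of `a` are distinct for distinct indices. -/
theorem eq_of_sum_tmul_eq (hq : q ≠ 0) {L : ℕ} {s t : Fin (L + 1) → O q} {w : Fin (L + 1) → ℂ}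
    (hw : ∀ i, w i ≠ 0)
    (h : ∑ i, (w i • (O.a q ^ (L - (i : ℕ)) * O.b q ^ (i : ℕ))) ⊗ₜ[ℂ] s i =
      ∑ i, (w i • (O.a q ^ (L - (i : ℕ)) * O.b q ^ (i : ℕ))) ⊗ₜ[ℂ] t i) : s = t := by
  funext i
  have key : ∀ r : Fin (L + 1) → O q,
      TensorProduct.lid ℂ (O q) (TensorProduct.map (coord hq (L - (i : ℕ))) LinearMap.id
        (∑ i, (w i • (O.a q ^ (L - (i : ℕ)) * O.b q ^ (i : ℕ))) ⊗ₜ[ℂ] r i)) = w i • r i := by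
    intro r
    rw [map_sum, map_sum, Finset.sum_eq_single i]
    · rw [TensorProduct.map_tmul, TensorProduct.lid_tmul, map_smul, coord_a_pow_mul_b_pow]
      simp
    · intro j _ hj
      rw [TensorProduct.map_tmul, TensorProduct.lid_tmul, map_smul, coord_a_pow_mul_b_pow,
        if_neg, smul_zero, zero_smul]
      have := Fin.val_ne_of_ne hj
      omega
    · simp
  have := key s
  rw [h, key t] at this
  exact (smul_right_injective _ (hw i) this).symm

/-! ### Powers of elements commuting up to a scalar -/

section QCommute

variable {B : Type*} [Ring B] [Algebra ℂ B]

theorem pow_mul_of_qcommute {x y : B} {s : ℂ} (h : x * y = s • (y * x)) (n : ℕ) :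
    x ^ n * y = s ^ n • (y * x ^ n) := by
  induction n with
  | zero => simp
  | succ n ih =>
    rw [pow_succ, mul_assoc, h, mul_smul_comm, ← mul_assoc, ih, smul_mul_assoc, smul_smul,
      mul_assoc, pow_succ']

theorem mul_pow_of_qcommute {x y : B} {s : ℂ} (h : x * y = s • (y * x)) (n : ℕ) :
    x * y ^ n = s ^ n • (y ^ n * x) := by
  induction n with
  | zero => simp
  | succ n ih =>
    rw [pow_succ, ← mul_assoc, ih, smul_mul_assoc, mul_assoc, h, mul_smul_comm, smul_smul,
      ← mul_assoc, pow_succ]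

theorem pow_mul_pow_of_qcommute {x y : B} {s : ℂ} (h : x * y = s • (y * x)) (n m : ℕ) :
    x ^ n * y ^ m = s ^ (n * m) • (y ^ m * x ^ n) := by
  rw [mul_pow_of_qcommute (pow_mul_of_qcommute h n) m, ← pow_mul]

end QCommute

theorem conj_ne_zero_of_ne_zero (hq : q ≠ 0) : conj q ≠ 0 := by simpa using hq

/-- The element `D a*`, the second coefficient of `Δ(b) = a ⊗ b + b ⊗ D a*`. -/
noncomputable def d (q : ℂ) : O q := O.D q * star (O.a q)

/-- The element `b b*`. -/
noncomputable def z (q : ℂ) : O q := O.b q * star (O.b q)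

/-! ### Commutation rules for `c`, `d` and `z` -/

section Rules

theorem b_mul_star_a (hq : q ≠ 0) : O.b q * star (O.a q) = q⁻¹ • (star (O.a q) * O.b q) :=
  ((O.relations q).rules hq).2.1

theorem D_mul_star_a (hq : q ≠ 0) : O.D q * star (O.a q) = (1 : ℂ) • (star (O.a q) * O.D q) := by
  obtain ⟨r1, r2, r3, r4, r5, r6, r7, r8, r9, r10, r11, r12, r13, r14, r15, r16, r17⟩ :=
    (O.relations q).rules hq
  rw [one_smul, r9]

theorem D_mul_b (hq : q ≠ 0) : O.D q * O.b q = (conj q / q) • (O.b q * O.D q) := by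
  obtain ⟨r1, r2, r3, r4, r5, r6, r7, r8, r9, r10, r11, r12, r13, r14, r15, r16, r17⟩ :=
    (O.relations q).rules hq
  have hc := conj_ne_zero_of_ne_zero hq
  rw [r12, smul_smul, div_mul_div_cancel₀ hq, div_self hc, one_smul]

theorem c_mul_a (hq : q ≠ 0) : c q * O.a q = conj q • (O.a q * c q) := by
  obtain ⟨r1, r2, r3, r4, r5, r6, r7, r8, r9, r10, r11, r12, r13, r14, r15, r16, r17⟩ :=
    (O.relations q).rules hq
  rw [c, neg_mul, smul_mul_assoc, mul_assoc, r3, mul_smul_comm, ← mul_assoc, ← r8, mul_neg,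
    mul_smul_comm, smul_neg, mul_assoc]

theorem c_mul_star_a (hq : q ≠ 0) : c q * star (O.a q) = (conj q)⁻¹ • (star (O.a q) * c q) := by
  obtain ⟨r1, r2, r3, r4, r5, r6, r7, r8, r9, r10, r11, r12, r13, r14, r15, r16, r17⟩ :=
    (O.relations q).rules hq
  rw [c, neg_mul, smul_mul_assoc, mul_assoc, r4, mul_smul_comm, ← mul_assoc, ← r9, mul_neg,
    mul_smul_comm, smul_neg, mul_assoc, smul_comm]

theorem commute_z_b (hq : q ≠ 0) : Commute (z q) (O.b q) := by
  obtain ⟨r1, r2, r3, r4, r5, r6, r7, r8, r9, r10, r11, r12, r13, r14, r15, r16, r17⟩ :=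
    (O.relations q).rules hq
  change z q * O.b q = O.b q * z q
  rw [z, mul_assoc, r5]

theorem commute_z_star_b (hq : q ≠ 0) : Commute (z q) (star (O.b q)) := by
  obtain ⟨r1, r2, r3, r4, r5, r6, r7, r8, r9, r10, r11, r12, r13, r14, r15, r16, r17⟩ :=
    (O.relations q).rules hq
  change z q * star (O.b q) = star (O.b q) * z q
  rw [z, ← mul_assoc, r5]

theorem commute_z_D (hq : q ≠ 0) : Commute (z q) (O.D q) := by
  obtain ⟨r1, r2, r3, r4, r5, r6, r7, r8, r9, r10, r11, r12, r13, r14, r15, r16, r17⟩ :=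
    (O.relations q).rules hq
  have hc := conj_ne_zero_of_ne_zero hq
  change z q * O.D q = O.D q * z q
  rw [z, mul_assoc, r13, mul_smul_comm, ← mul_assoc, r12, smul_mul_assoc, smul_smul,
    div_mul_div_cancel₀ hq, div_self hc, one_smul, mul_assoc]

theorem commute_z_c (hq : q ≠ 0) : Commute (z q) (c q) :=
  (((commute_z_D hq).mul_right (commute_z_star_b hq)).smul_right _).neg_right

theorem star_a_mul_z (hq : q ≠ 0) : star (O.a q) * z q = (q * conj q) • (z q * star (O.a q)) := by
  obtain ⟨r1, r2, r3, r4, r5, r6, r7, r8, r9, r10, r11, r12, r13, r14, r15, r16, r17⟩ :=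
    (O.relations q).rules hq
  have hc := conj_ne_zero_of_ne_zero hq
  rw [z, mul_assoc (O.b q), r4, mul_smul_comm, ← mul_assoc (O.b q), r2, smul_mul_assoc, smul_smul, smul_smul,
    show q * conj q * (conj q)⁻¹ * q⁻¹ = 1 by field_simp, one_smul, mul_assoc]

theorem c_mul_b (hq : q ≠ 0) : c q * O.b q = -(conj q • (z q * O.D q)) := by
  obtain ⟨r1, r2, r3, r4, r5, r6, r7, r8, r9, r10, r11, r12, r13, r14, r15, r16, r17⟩ :=
    (O.relations q).rules hq
  rw [(commute_z_D hq).eq, c, z, neg_mul, smul_mul_assoc, mul_assoc, r5]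

/-- The innermost pair `c b` becomes a multiple of `z D`; carrying `D` past the remaining `b^p`
costs `(q̄/q)^p`. -/
theorem c_pow_succ_mul_b_pow_succ (hq : q ≠ 0) (m p : ℕ) :
    c q ^ (m + 1) * O.b q ^ (p + 1) =
      (-conj q * (conj q / q) ^ p) • (z q * (c q ^ m * O.b q ^ p * O.D q)) := by
  rw [pow_succ (c q), pow_succ' (O.b q), mul_assoc, ← mul_assoc (c q) (O.b q), c_mul_b hq,
    neg_mul, smul_mul_assoc, mul_assoc (z q), mul_pow_of_qcommute (D_mul_b hq), mul_neg,
    mul_smul_comm, mul_smul_comm, mul_smul_comm, ← mul_assoc (c q ^ m),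
    ← ((commute_z_c hq).pow_right m).eq, smul_smul, ← neg_smul, neg_mul]
  simp only [mul_assoc]

/-- Here `a a* = 1 - z`, and the term with `z D` is read backwards as one more pair `c b`. This
splitting drives the double Pascal rule for `i ≤ N`. -/
theorem a_mul_star_a_mul (hq : q ≠ 0) (m p : ℕ) :
    O.a q * (star (O.a q) * (c q ^ m * O.b q ^ p * O.D q)) = c q ^ m * O.b q ^ p * O.D q +
      ((conj q)⁻¹ * (q / conj q) ^ p) • (c q ^ (m + 1) * O.b q ^ (p + 1)) := by
  obtain ⟨r1, r2, r3, r4, r5, r6, r7, r8, r9, r10, r11, r12, r13, r14, r15, r16, r17⟩ :=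
    (O.relations q).rules hq
  have hc := conj_ne_zero_of_ne_zero hq
  rw [c_pow_succ_mul_b_pow_succ hq, smul_smul, ← mul_assoc, r6, sub_mul, one_mul, ← z]
  have : (conj q)⁻¹ * (q / conj q) ^ p * (-conj q * (conj q / q) ^ p) = -1 := by
    rw [← inv_div q, inv_pow]
    field_simp
  rw [this, neg_one_smul, sub_eq_add_neg]

theorem c_pow_mul_b_pow_mul_D_pow_mul_d (hq : q ≠ 0) (m p k : ℕ) :
    c q ^ m * O.b q ^ p * O.D q ^ k * d q =
      (q⁻¹ ^ p * (conj q)⁻¹ ^ m) • (star (O.a q) * (c q ^ m * O.b q ^ p * O.D q ^ (k + 1))) := by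
  have h1 := pow_mul_of_qcommute (D_mul_star_a hq) (k + 1)
  rw [one_pow, one_smul] at h1
  rw [d, ← mul_assoc, mul_assoc _ (O.D q ^ k), ← pow_succ, mul_assoc, h1, ← mul_assoc,
    mul_assoc (c q ^ m), pow_mul_of_qcommute (b_mul_star_a hq), mul_smul_comm, ← mul_assoc,
    pow_mul_of_qcommute (c_mul_star_a hq), smul_mul_assoc, smul_mul_assoc, smul_mul_assoc,
    smul_smul]
  simp only [mul_assoc]

theorem mul_D_pow_mul_b (hq : q ≠ 0) (x : O q) (p k : ℕ) :
    x * O.b q ^ p * O.D q ^ k * O.b q =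
      (conj q / q) ^ k • (x * O.b q ^ (p + 1) * O.D q ^ k) := by
  rw [mul_assoc _ _ (O.b q), pow_mul_of_qcommute (D_mul_b hq), mul_smul_comm, ← mul_assoc,
    mul_assoc x, ← pow_succ]

end Rules

/-! ### Expansion of `Δ(a^N b^j)` -/

/-- Right multiplication of `∑ i, a ^ (L - i) * b ^ i ⊗ V i` by `a ⊗ x + b ⊗ y`, on the second
tensor factors. -/
noncomputable def step (V : ℕ → O q) (x y : O q) : ℕ → O q
  | 0 => V 0 * x
  | i + 1 => q ^ (i + 1) • (V (i + 1) * x) + V i * y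

/-- The coefficients of `Δ(a ^ N * b ^ j)` with respect to `a ^ (N + j - i) * b ^ i`. -/
noncomputable def coeff (q : ℂ) (N j : ℕ) : ℕ → O q :=
  (fun V => step V (O.b q) (d q))^[j] ((fun V => step V (O.a q) (c q))^[N]
    fun i => if i = 0 then 1 else 0)

theorem coeff_zero_zero (i : ℕ) : coeff q 0 0 i = if i = 0 then 1 else 0 := rfl

theorem coeff_succ_zero (N : ℕ) : coeff q (N + 1) 0 = step (coeff q N 0) (O.a q) (c q) := by
  rw [coeff, Function.iterate_succ_apply']
  rfl

theorem coeff_succ (N j : ℕ) : coeff q N (j + 1) = step (coeff q N j) (O.b q) (d q) := by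
  rw [coeff, Function.iterate_succ_apply']
  rfl

theorem step_eq_zero {V : ℕ → O q} {L : ℕ} (h : ∀ i, L < i → V i = 0) (x y : O q) {i : ℕ}
    (hi : L + 1 < i) : step V x y i = 0 := by
  obtain ⟨i, rfl⟩ := Nat.exists_eq_succ_of_ne_zero (Nat.ne_of_gt (Nat.zero_lt_of_lt hi))
  rw [Nat.succ_eq_add_one, step, h _ (by omega), h _ (by omega)]
  simp

theorem coeff_eq_zero (N j : ℕ) : ∀ i, N + j < i → coeff q N j i = 0 := by
  induction j with
  | zero =>
    induction N with
    | zero => intro i hi; rw [coeff_zero_zero, if_neg (by omega)]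
    | succ N ih =>
      intro i hi
      rw [coeff_succ_zero]
      exact step_eq_zero ih _ _ (by omega)
  | succ j ih =>
    intro i hi
    rw [coeff_succ]
    exact step_eq_zero ih _ _ (by omega)

/-- Moving the new `a` left past `b^i` costs `q^i`. The vanishing of `V (L + 1)` lets the `a`-part
be summed over the longer range. -/
theorem sum_tmul_mul {V : ℕ → O q} {L : ℕ} (h : V (L + 1) = 0) (x y : O q) :
    (∑ i ∈ Finset.range (L + 1), (O.a q ^ (L - i) * O.b q ^ i) ⊗ₜ[ℂ] V i) *
        (O.a q ⊗ₜ[ℂ] x + O.b q ⊗ₜ[ℂ] y) =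
      ∑ i ∈ Finset.range (L + 2), (O.a q ^ (L + 1 - i) * O.b q ^ i) ⊗ₜ[ℂ] step V x y i := by
  have h1 : ∑ i ∈ Finset.range (L + 1),
      ((O.a q ^ (L - i) * O.b q ^ i) ⊗ₜ[ℂ] V i) * (O.a q ⊗ₜ[ℂ] x) =
      ∑ i ∈ Finset.range (L + 2),
        (O.a q ^ (L + 1 - i) * O.b q ^ i) ⊗ₜ[ℂ] (q ^ i • (V i * x)) := by
    rw [Finset.sum_range_succ _ (L + 1), h, zero_mul, smul_zero, TensorProduct.tmul_zero, add_zero]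
    refine Finset.sum_congr rfl fun i hi => ?_
    have hi := Finset.mem_range.1 hi
    rw [Algebra.TensorProduct.tmul_mul_tmul, mul_assoc,
      pow_mul_of_qcommute (O.relations q).ba, mul_smul_comm, ← TensorProduct.smul_tmul',
      TensorProduct.tmul_smul, ← mul_assoc, ← pow_succ, show L + 1 - i = L - i + 1 by omega]
  rw [mul_add, Finset.sum_mul, Finset.sum_mul, h1, Finset.sum_range_succ' _ (L + 1),
    Finset.sum_range_succ' _ (L + 1), add_right_comm, ← Finset.sum_add_distrib]
  congr 1
  · refine Finset.sum_congr rfl fun i hi => ?_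
    rw [Algebra.TensorProduct.tmul_mul_tmul, mul_assoc, ← pow_succ, Nat.add_sub_add_right,
      ← TensorProduct.tmul_add, step]
  · simp [step]

theorem comul_a (hq : q ≠ 0) :
    comul hq (O.a q) = O.a q ⊗ₜ[ℂ] O.a q + O.b q ⊗ₜ[ℂ] c q := by
  rw [comul, O.lift_a, c, TensorProduct.tmul_neg, TensorProduct.tmul_smul, sub_eq_add_neg]

theorem comul_b (hq : q ≠ 0) :
    comul hq (O.b q) = O.a q ⊗ₜ[ℂ] O.b q + O.b q ⊗ₜ[ℂ] d q := by
  rw [comul, O.lift_b, d]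

theorem comul_a_pow_mul_b_pow (hq : q ≠ 0) (N j : ℕ) :
    comul hq (O.a q ^ N * O.b q ^ j) =
      ∑ i ∈ Finset.range (N + j + 1),
        (O.a q ^ (N + j - i) * O.b q ^ i) ⊗ₜ[ℂ] coeff q N j i := by
  induction j with
  | zero =>
    rw [pow_zero, mul_one]
    induction N with
    | zero => simp [coeff_zero_zero, Algebra.TensorProduct.one_def]
    | succ N ih =>
      rw [pow_succ, map_mul, ih, comul_a, add_zero,
        sum_tmul_mul (coeff_eq_zero N 0 _ (by omega)), coeff_succ_zero]
  | succ j ih =>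
    rw [pow_succ, ← mul_assoc, map_mul, ih, comul_b,
      sum_tmul_mul (coeff_eq_zero N j _ (by omega)), coeff_succ]
    rfl

/-- The `Q`-binomial theorem for `a ⊗ a` and `b ⊗ c`: exchanging them costs `q` in the first leg and
`q̄` in the second. -/
theorem coeff_zero_right (hq : q ≠ 0) (N i : ℕ) :
    coeff q N 0 i = gauss (q * conj q) N i • (O.a q ^ (N - i) * c q ^ i) := by
  induction N generalizing i with
  | zero => cases i <;> simp [coeff_zero_zero]
  | succ N ih =>
    rw [coeff_succ_zero]
    cases i with
    | zero => simp [step, ih, pow_succ]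
    | succ i =>
      rw [step, ih, ih, gauss_succ_succ, add_smul, add_comm, Nat.add_sub_add_right]
      congr 1
      · rw [smul_mul_assoc, mul_assoc, ← pow_succ]
      · rcases lt_or_ge N (i + 1) with h | h
        · simp [gauss_eq_zero _ h]
        · obtain ⟨n, rfl⟩ := Nat.exists_eq_add_of_le' h
          rw [smul_mul_assoc, mul_assoc, pow_mul_of_qcommute (c_mul_a hq), mul_smul_comm,
            ← mul_assoc, ← pow_succ, smul_smul, smul_smul, Nat.add_sub_cancel,
            show n + (i + 1) - i = n + 1 by omega]
          congr 1
          ring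

/-! ### Closed formulas for `coeff` as sums over words in `c`, `b`, `D` -/

/-- The power of `q` and `q̄` in front of `c ^ m * b ^ (j - k) * D ^ k`. -/
noncomputable def weight (q : ℂ) (j m k : ℕ) : ℂ := q⁻¹ ^ ((j - k) * k) * (conj q)⁻¹ ^ (m * j)

/-- Appending `b` yields `q^(m+k)` from `step` and `(q̄/q)^k` from crossing `D^k`; relative to the
new weight this is the power of `Q` that Pascal demands. -/
theorem weight_mul_b (hq : q ≠ 0) {j k : ℕ} (h : k ≤ j) (m : ℕ) :
    q ^ (m + k) * (conj q / q) ^ k * weight q j m k =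
      (q * conj q) ^ (m + k) * weight q (j + 1) m k := by
  have hc := conj_ne_zero_of_ne_zero hq
  obtain ⟨p, rfl⟩ := Nat.exists_eq_add_of_le' h
  rw [weight, weight, show p + k + 1 - k = p + 1 by omega, Nat.add_sub_cancel]
  simp only [div_pow, inv_pow, mul_pow]
  field_simp
  ring

theorem weight_mul_d (j m k : ℕ) :
    q⁻¹ ^ (j - k) * (conj q)⁻¹ ^ m * weight q j m k = weight q (j + 1) m (k + 1) := by
  rw [weight, weight, Nat.add_sub_add_right]
  ring

theorem weight_mul_d' (hq : q ≠ 0) {j k : ℕ} (h : k ≤ j) (m : ℕ) :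
    q⁻¹ ^ (j - k) * (conj q)⁻¹ ^ m * ((conj q)⁻¹ * (q / conj q) ^ (j - k)) * weight q j m k =
      (q * conj q) ^ k * weight q (j + 1) (m + 1) k := by
  have hc := conj_ne_zero_of_ne_zero hq
  obtain ⟨p, rfl⟩ := Nat.exists_eq_add_of_le' h
  rw [weight, weight, show p + k + 1 - k = p + 1 by omega, Nat.add_sub_cancel]
  simp only [div_pow, inv_pow, mul_pow]
  field_simp
  ring

/-- Applying Pascal to both binomials gives three terms. One comes from appending `b`; the other two
come from appending `d`, whose `a*` meets the last `a` and raises either `k` or `m` by one. -/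
theorem coeff_eq_sum_of_le (hq : q ≠ 0) (N j : ℕ) : ∀ i ≤ N, coeff q N j i =
    ∑ x ∈ Finset.HasAntidiagonal.antidiagonal i,
      (gauss (q * conj q) j x.2 * gauss (q * conj q) (N + (j - x.2)) x.1 * weight q j x.1 x.2) •
        (O.a q ^ (N - i) * (c q ^ x.1 * O.b q ^ (j - x.2) * O.D q ^ x.2)) := by
  induction j with
  | zero =>
    intro i _
    rw [coeff_zero_right hq, Finset.sum_eq_single (i, 0)]
    · simp [weight]
    · rintro ⟨m, k⟩ hx hne
      obtain ⟨k, rfl⟩ : ∃ k', k = k' + 1 := by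
        refine Nat.exists_eq_succ_of_ne_zero fun hk => hne ?_
        subst hk
        rw [← Finset.HasAntidiagonal.mem_antidiagonal.1 hx, add_zero]
      simp
    · simp
  | succ j ih =>
    intro i hi
    rw [coeff_succ]
    cases i with
    | zero =>
      rw [step, ih 0 hi]
      simp [weight, mul_assoc, pow_succ]
    | succ i =>
      obtain ⟨n, rfl⟩ := Nat.exists_eq_add_of_le' hi
      rw [step, ih _ hi, ih i (by omega), Nat.add_sub_cancel,
        show n + (i + 1) - i = n + 1 by omega]
      set N := n + (i + 1) with hN
      set Q := q * conj q with hQ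
      let B : ℕ → ℕ → ℕ → O q := fun m p k => O.a q ^ n * (c q ^ m * O.b q ^ p * O.D q ^ k)
      have target : ∀ x ∈ Finset.HasAntidiagonal.antidiagonal (i + 1),
          (gauss Q (j + 1) x.2 * gauss Q (N + (j + 1 - x.2)) x.1 * weight q (j + 1) x.1 x.2) •
            B x.1 (j + 1 - x.2) x.2 =
          (Q ^ x.2 * gauss Q j x.2 * (Q ^ x.1 * gauss Q (N + (j - x.2)) x.1) *
            weight q (j + 1) x.1 x.2) • B x.1 (j + 1 - x.2) x.2 +
          ((gaussPred Q j x.2 * gauss Q (N + (j + 1 - x.2)) x.1 * weight q (j + 1) x.1 x.2) •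
            B x.1 (j + 1 - x.2) x.2 +
          (Q ^ x.2 * gauss Q j x.2 * gaussPred Q (N + (j - x.2)) x.1 *
            weight q (j + 1) x.1 x.2) • B x.1 (j + 1 - x.2) x.2) := by
        rintro ⟨m, k⟩ -
        rw [← add_smul, ← add_smul]
        congr 1
        dsimp only
        rw [gauss_succ Q j k]
        rcases lt_or_ge j k with h | h
        · rw [gauss_eq_zero Q h]; ring
        · rw [show N + (j + 1 - k) = N + (j - k) + 1 by omega, gauss_succ Q (N + (j - k)) m]
          ring
      refine Eq.trans ?_ (Finset.sum_congr rfl target).symm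
      rw [Finset.sum_add_distrib, Finset.sum_add_distrib]
      congr 1
      · rw [Finset.sum_mul, Finset.smul_sum]
        refine Finset.sum_congr rfl fun x hx => ?_
        obtain ⟨m, k⟩ := x
        dsimp only
        rcases lt_or_ge j k with h | h
        · simp [gauss_eq_zero Q h]
        · rw [← Finset.HasAntidiagonal.mem_antidiagonal.1 hx, smul_mul_assoc, ← mul_assoc, ← mul_assoc,
            mul_D_pow_mul_b hq, smul_smul, smul_smul, show j + 1 - k = j - k + 1 by omega]
          simp only [B, mul_assoc (O.a q ^ n)]
          congr 1
          linear_combination gauss Q j k * gauss Q (N + (j - k)) m * weight_mul_b hq h m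
      -- The contribution of `d`: one sum is shifted in `k`, the other in `m`, and both boundary
      -- terms vanish because `gaussPred` is `0` at `0`.
      · rw [Finset.Nat.sum_antidiagonal_succ', Finset.Nat.sum_antidiagonal_succ]
        simp only [gaussPred, zero_mul, mul_zero, zero_smul, zero_add]
        rw [Finset.sum_mul, ← Finset.sum_add_distrib]
        refine Finset.sum_congr rfl fun x _ => ?_
        obtain ⟨m, k⟩ := x
        dsimp only
        rw [Nat.add_sub_add_right]
        -- The hypothesis `i + 1 ≤ N` supplies the factor `a` in `a^(n+1)` next to which `a*` is
        -- brought.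
        have key : O.a q ^ (n + 1) * (c q ^ m * O.b q ^ (j - k) * O.D q ^ k) * d q =
            (q⁻¹ ^ (j - k) * (conj q)⁻¹ ^ m) • (B m (j - k) (k + 1) +
              ((conj q)⁻¹ * (q / conj q) ^ (j - k)) • B (m + 1) (j - k + 1) k) := by
          have := congrArg (fun w => O.a q ^ n * (w * O.D q ^ k))
            (a_mul_star_a_mul hq m (j - k))
          rw [mul_assoc (O.a q ^ (n + 1)), c_pow_mul_b_pow_mul_D_pow_mul_d hq, mul_smul_comm, pow_succ]
          congr 1
          simp only [B, add_mul, mul_add, smul_mul_assoc, mul_smul_comm, mul_assoc, pow_succ'] at this ⊢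
          exact this
        rw [smul_mul_assoc, key, smul_add, smul_add, smul_smul, smul_smul, smul_smul]
        congr 1
        · congr 1
          rw [← weight_mul_d]
          ring
        · rcases lt_or_ge j k with h | h
          · simp [gauss_eq_zero Q h]
          · rw [show j + 1 - k = j - k + 1 by omega]
            congr 1
            linear_combination gauss Q j k * gauss Q (N + (j - k)) m * weight_mul_d' hq h m

/-- On the diagonal `i = N` this is the previous formula after the trinomial identity. Beyond it no
`a` is left, so `d` just adds one `a*` and one `D`, and Pascal is needed only for the second
binomial. -/
theorem coeff_eq_sum_of_ge (hq : q ≠ 0) (hQ : ∀ r : ℕ, (q * conj q) ^ (r + 1) ≠ 1) (N j : ℕ) :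
    ∀ i, N ≤ i → coeff q N j i =
    ∑ x ∈ Finset.HasAntidiagonal.antidiagonal i,
      (gauss (q * conj q) N x.1 * gauss (q * conj q) (j + x.1) (x.1 + x.2) *
        weight q j x.1 x.2) •
        (star (O.a q) ^ (i - N) * (c q ^ x.1 * O.b q ^ (j - x.2) * O.D q ^ x.2)) := by
  have diag : ∀ j, coeff q N j N =
    ∑ x ∈ Finset.HasAntidiagonal.antidiagonal N,
      (gauss (q * conj q) N x.1 * gauss (q * conj q) (j + x.1) (x.1 + x.2) *
        weight q j x.1 x.2) •
        (star (O.a q) ^ (N - N) * (c q ^ x.1 * O.b q ^ (j - x.2) * O.D q ^ x.2)) := by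
    intro j
    rw [coeff_eq_sum_of_le hq N j N le_rfl]
    refine Finset.sum_congr rfl fun x hx => ?_
    obtain ⟨m, k⟩ := x
    have hx : m + k = N := Finset.HasAntidiagonal.mem_antidiagonal.1 hx
    dsimp only
    rw [Nat.sub_self, pow_zero, pow_zero]
    congr 2
    subst hx
    rcases lt_or_ge j k with h | h
    · rw [gauss_eq_zero _ h, gauss_eq_zero _ (show j + m < m + k by omega), zero_mul, mul_zero]
    · obtain ⟨p, rfl⟩ := Nat.exists_eq_add_of_le' h
      rw [Nat.add_sub_cancel, ← gauss_mul_gauss_comm hQ,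
        show m + k + p = p + k + m by omega]
  induction j with
  | zero =>
    intro i hi
    rcases hi.eq_or_lt with rfl | hi
    · exact diag 0
    rw [coeff_eq_zero _ _ _ (by omega)]
    symm
    refine Finset.sum_eq_zero fun x hx => ?_
    obtain ⟨m, k⟩ := x
    have hx : m + k = i := Finset.HasAntidiagonal.mem_antidiagonal.1 hx
    dsimp only
    rcases Nat.eq_zero_or_pos k with rfl | hk
    · rw [gauss_eq_zero _ (show N < m by omega)]; simp
    · rw [gauss_eq_zero _ (show 0 + m < m + k by omega)]; simp
  | succ j ih =>
    intro i hi
    rcases hi.eq_or_lt with rfl | hi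
    · exact diag (j + 1)
    obtain ⟨e, rfl⟩ := Nat.exists_eq_add_of_lt hi
    set i := N + e with hie
    rw [coeff_succ, step, ih _ (by omega), ih _ (by omega), show i + 1 - N = e + 1 by omega,
      show i - N = e by omega]
    set Q := q * conj q
    let B : ℕ → ℕ → ℕ → O q := fun m p k =>
      star (O.a q) ^ (e + 1) * (c q ^ m * O.b q ^ p * O.D q ^ k)
    have target : ∀ x ∈ Finset.HasAntidiagonal.antidiagonal (i + 1),
        (gauss Q N x.1 * gauss Q (j + 1 + x.1) (x.1 + x.2) * weight q (j + 1) x.1 x.2) •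
          B x.1 (j + 1 - x.2) x.2 =
        (gauss Q N x.1 * (Q ^ (x.1 + x.2) * gauss Q (j + x.1) (x.1 + x.2)) *
          weight q (j + 1) x.1 x.2) • B x.1 (j + 1 - x.2) x.2 +
        (gauss Q N x.1 * gaussPred Q (j + x.1) (x.1 + x.2) * weight q (j + 1) x.1 x.2) •
          B x.1 (j + 1 - x.2) x.2 := by
      rintro ⟨m, k⟩ -
      rw [← add_smul]
      congr 1
      dsimp only
      rw [add_right_comm, gauss_succ Q (j + m)]
      ring
    refine Eq.trans ?_ (Finset.sum_congr rfl target).symm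
    rw [Finset.sum_add_distrib]
    congr 1
    · rw [Finset.sum_mul, Finset.smul_sum]
      refine Finset.sum_congr rfl fun x hx => ?_
      obtain ⟨m, k⟩ := x
      dsimp only
      rcases lt_or_ge j k with h | h
      · simp [gauss_eq_zero Q (show j + m < m + k by omega)]
      · rw [← Finset.HasAntidiagonal.mem_antidiagonal.1 hx, smul_mul_assoc, ← mul_assoc, ← mul_assoc,
          mul_D_pow_mul_b hq, smul_smul, smul_smul, show j + 1 - k = j - k + 1 by omega]
        simp only [B, mul_assoc (star (O.a q) ^ (e + 1))]
        congr 1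
        linear_combination gauss Q N m * gauss Q (j + m) (m + k) * weight_mul_b hq h m
    · rw [Finset.Nat.sum_antidiagonal_succ']
      dsimp only
      -- The boundary term `k = 0` has `m = i + 1 > N`, so the first binomial kills it.
      rw [gauss_eq_zero Q (show N < i + 1 by omega), zero_mul, zero_mul, zero_smul, zero_add,
        Finset.sum_mul]
      refine Finset.sum_congr rfl fun x _ => ?_
      obtain ⟨m, k⟩ := x
      dsimp only
      rw [Nat.add_sub_add_right, smul_mul_assoc, mul_assoc (star (O.a q) ^ e),
        c_pow_mul_b_pow_mul_D_pow_mul_d hq, mul_smul_comm, smul_smul, ← mul_assoc (star (O.a q) ^ e),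
        ← pow_succ]
      congr 1
      rw [← weight_mul_d, ← add_assoc, gaussPred]
      ring

/-! ### Collapsing `c^m b^m` and recognising the Jacobi polynomials -/

/-- The scalar `μ` in `c ^ m * b ^ m = μ • (z ^ m * D ^ m)`. -/
noncomputable def cbScalar (q : ℂ) (m : ℕ) : ℂ :=
  (-1) ^ m * conj q ^ m * (conj q / q) ^ m.choose 2

theorem c_pow_mul_b_pow (hq : q ≠ 0) (m : ℕ) :
    c q ^ m * O.b q ^ m = cbScalar q m • (z q ^ m * O.D q ^ m) := by
  induction m with
  | zero => simp [cbScalar]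
  | succ m ih =>
    rw [c_pow_succ_mul_b_pow_succ hq, ih, smul_mul_assoc, mul_smul_comm, smul_smul,
      mul_assoc (z q ^ m), ← pow_succ, ← mul_assoc (z q), ← pow_succ', cbScalar, cbScalar,
      Nat.choose_succ_succ' m 1, Nat.choose_one_right]
    congr 1
    ring

theorem c_pow_mul_b_pow_add_mul_D_pow (hq : q ≠ 0) (m p k : ℕ) :
    c q ^ m * O.b q ^ (m + p) * O.D q ^ k =
      (cbScalar q m * (conj q / q) ^ (m * p)) • (z q ^ m * (O.b q ^ p * O.D q ^ (k + m))) := by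
  rw [pow_add (O.b q), ← mul_assoc, c_pow_mul_b_pow hq, smul_mul_assoc, smul_mul_assoc,
    mul_assoc (z q ^ m), pow_mul_pow_of_qcommute (D_mul_b hq), mul_smul_comm, smul_mul_assoc,
    smul_smul, add_comm k m, pow_add (O.D q) m]
  simp only [mul_assoc]

theorem c_pow_add_mul_b_pow_mul_D_pow (hq : q ≠ 0) (m p k : ℕ) :
    c q ^ (p + m) * O.b q ^ m * O.D q ^ k =
      cbScalar q m • (z q ^ m * (c q ^ p * O.D q ^ (k + m))) := by
  rw [pow_add (c q), mul_assoc (c q ^ p), c_pow_mul_b_pow hq, mul_smul_comm, smul_mul_assoc,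
    ← mul_assoc (c q ^ p), ← ((commute_z_c hq).pow_pow m p).eq, add_comm k m, pow_add (O.D q)]
  simp only [mul_assoc]

/-- The phases cancel. Beyond the prefactor `q^(-p(k+m))`, depending on `k + m` only, there remain
the sign and power of `Q` of `jacobiCoeff` with `n = k + m`, `s = m`. -/
theorem weight_mul_cbScalar_b (hq : q ≠ 0) (k m p : ℕ) :
    weight q (k + m + p) m k * (cbScalar q m * (conj q / q) ^ (m * p)) =
      q⁻¹ ^ (p * (k + m)) * ((-1) ^ m * (q * conj q) ^ (m + m.choose 2) *
        ((q * conj q) ^ ((k + m) * m))⁻¹) := by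
  have hc := conj_ne_zero_of_ne_zero hq
  -- Needed to compare the quadratic exponent `m * m` with `m.choose 2`.
  have hm : m * m = 2 * m.choose 2 + m := by
    have := Nat.choose_two_right m
    have h2 : 2 ∣ m * (m - 1) := (Nat.even_mul_pred_self m).two_dvd
    cases m with
    | zero => rfl
    | succ m => rw [Nat.add_sub_cancel] at *; have := Nat.div_mul_cancel h2; nlinarith
  rw [weight, cbScalar, show k + m + p - k = m + p by omega]
  simp only [div_pow, inv_pow, mul_pow, add_mul, mul_add, pow_add, hm, mul_inv]
  field_simp
  ring

/-- The extra `c^p` changes the weight only by `q̄^(-p(k+m))`, so the case `p = 0` of the preceding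
lemma suffices. -/
theorem weight_mul_cbScalar_c (hq : q ≠ 0) (k m p : ℕ) :
    weight q (k + m) (p + m) k * cbScalar q m =
      (conj q)⁻¹ ^ (p * (k + m)) * ((-1) ^ m * (q * conj q) ^ (m + m.choose 2) *
        ((q * conj q) ^ ((k + m) * m))⁻¹) := by
  have h := weight_mul_cbScalar_b hq k m 0
  simp only [add_zero, mul_zero, pow_zero, mul_one, zero_mul, one_mul] at h
  rw [← h, weight, weight, add_mul p m, pow_add]
  ring

theorem star_a_pow_mul_z_pow (hq : q ≠ 0) (e m : ℕ) (x : O q) :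
    star (O.a q) ^ e * (z q ^ m * x) =
      (q * conj q) ^ (e * m) • (z q ^ m * (star (O.a q) ^ e * x)) := by
  rw [← mul_assoc, pow_mul_pow_of_qcommute (star_a_mul_z hq), smul_mul_assoc, mul_assoc]

theorem jacobi_eq_sum (hq : q ≠ 0) (hQ : ∀ r : ℕ, (q * conj q) ^ (r + 1) ≠ 1) (n α β : ℕ) :
    jacobi q n α β =
      ∑ s ∈ Finset.range (n + 1), jacobiCoeff (q * conj q) n α β s • z q ^ s := by
  rw [jacobi, normSq_eq,
    littleJacobi_eq_sum (mul_ne_zero hq (conj_ne_zero_of_ne_zero hq)) hQ, map_sum]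
  refine Finset.sum_congr rfl fun s _ => ?_
  rw [map_mul, map_pow, Polynomial.aeval_X, Polynomial.aeval_C, Algebra.smul_def, z]

/-- For use when `i = p + j ≥ j`: vanishing for `k > j` forces at least `p` factors `c`, and the
surplus `s` becomes the exponent of `z`. -/
theorem sum_antidiagonal_add {M : Type*} [AddCommMonoid M] (f : ℕ × ℕ → M) (p j : ℕ)
    (h : ∀ m k, j < k → f (m, k) = 0) :
    ∑ x ∈ Finset.HasAntidiagonal.antidiagonal (p + j), f x =
      ∑ s ∈ Finset.range (j + 1), f (p + s, j - s) := by
  rw [Finset.Nat.sum_antidiagonal_eq_sum_range_succ_mk, Nat.succ_eq_add_one, add_assoc,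
    Finset.sum_range_add, Finset.sum_eq_zero, zero_add]
  · refine Finset.sum_congr rfl fun s _ => ?_
    rw [Nat.add_sub_add_left]
  · intro m hm
    have := Finset.mem_range.1 hm
    exact h _ _ (by omega)

/-- Each `c` finds a partner among the `m + p` factors `b`; `b^p` is left over. -/
theorem coeff_of_add_le_of_le (hq : q ≠ 0)
    (hQ : ∀ r : ℕ, (q * conj q) ^ (r + 1) ≠ 1) (i n p : ℕ) :
    coeff q (i + n) (i + p) i = (q⁻¹ ^ (p * i) * gauss (q * conj q) (i + p) p) •
      (O.a q ^ n * O.b q ^ p * jacobi q i p n * O.D q ^ i) := by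
  rw [coeff_eq_sum_of_le hq _ _ _ (by omega), jacobi_eq_sum hq hQ,
    Finset.Nat.sum_antidiagonal_eq_sum_range_succ_mk, Finset.mul_sum, Finset.sum_mul,
    Finset.smul_sum]
  refine Finset.sum_congr rfl fun m hm => ?_
  obtain ⟨k, rfl⟩ := Nat.exists_eq_add_of_le' (Nat.lt_succ_iff.1 (Finset.mem_range.1 hm))
  dsimp only
  rw [Nat.add_sub_cancel, show k + m + p - k = m + p by omega,
    c_pow_mul_b_pow_add_mul_D_pow hq, Nat.add_sub_cancel_left]
  simp only [mul_smul_comm, smul_mul_assoc, smul_smul, mul_assoc]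
  rw [← mul_assoc (z q ^ m), ((commute_z_b hq).pow_pow m p).eq, mul_assoc]
  congr 1
  have hw := weight_mul_cbScalar_b hq k m p
  have hg := gauss_mul_gauss_mul_qPoch hQ k p (k + m + n + p) m
  have hs := gauss_symm hQ (p + m) k
  have hP := qPoch_pow_ne_zero hQ p m
  rw [show p + m + k = k + m + p by omega] at hs
  rw [show k + m + n + (m + p) = k + m + n + p + m by omega, jacobiCoeff,
    show p + n + (k + m) + 1 = k + m + n + p + 1 by omega, hs]
  field_simp
  linear_combination (gauss (q * conj q) (k + m + p) (p + m) *
      gauss (q * conj q) (k + m + n + p + m) m * qPoch ((q * conj q) ^ (p + 1)) (q * conj q) m) * hw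
    + (q⁻¹ ^ (p * (k + m)) * ((-1) ^ m * (q * conj q) ^ (m + m.choose 2) *
        ((q * conj q) ^ ((k + m) * m))⁻¹)) * hg

/-- Now the `c` outnumber the `b`, so `c^p` is left over. -/
theorem coeff_of_add_le_of_ge (hq : q ≠ 0)
    (hQ : ∀ r : ℕ, (q * conj q) ^ (r + 1) ≠ 1) (j n p : ℕ) :
    coeff q (p + j + n) j (p + j) = ((conj q)⁻¹ ^ (p * j) * gauss (q * conj q) (p + j + n) p) •
      (O.a q ^ n * c q ^ p * jacobi q j p n * O.D q ^ j) := by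
  rw [coeff_eq_sum_of_le hq _ _ _ (by omega), jacobi_eq_sum hq hQ, sum_antidiagonal_add,
    Finset.mul_sum, Finset.sum_mul, Finset.smul_sum]
  · refine Finset.sum_congr rfl fun m hm => ?_
    obtain ⟨k, rfl⟩ := Nat.exists_eq_add_of_le' (Nat.lt_succ_iff.1 (Finset.mem_range.1 hm))
    dsimp only
    rw [Nat.add_sub_cancel, Nat.add_sub_cancel_left, c_pow_add_mul_b_pow_mul_D_pow hq,
      Nat.add_sub_cancel_left]
    simp only [mul_smul_comm, smul_mul_assoc, smul_smul, mul_assoc]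
    rw [← mul_assoc (z q ^ m), ((commute_z_c hq).pow_pow m p).eq, mul_assoc]
    congr 1
    have hw := weight_mul_cbScalar_c hq k m p
    have hg := gauss_add_mul_qPoch hQ (show p ≤ p + (k + m) + n by omega) m
    have hs := gauss_symm hQ m k
    have hP := qPoch_pow_ne_zero hQ p m
    rw [add_comm m k] at hs
    rw [jacobiCoeff, show p + n + (k + m) + 1 = p + (k + m) + n + 1 by omega, hs]
    field_simp
    linear_combination (gauss (q * conj q) (k + m) m *
        gauss (q * conj q) (p + (k + m) + n + m) (p + m) *
        qPoch ((q * conj q) ^ (p + 1)) (q * conj q) m) * hw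
      + (gauss (q * conj q) (k + m) m * (conj q)⁻¹ ^ (p * (k + m)) *
        ((-1) ^ m * (q * conj q) ^ (m + m.choose 2) * ((q * conj q) ^ ((k + m) * m))⁻¹)) * hg
  · intro m k h
    simp [gauss_eq_zero _ h]

theorem coeff_of_le_add_of_le (hq : q ≠ 0)
    (hQ : ∀ r : ℕ, (q * conj q) ^ (r + 1) ≠ 1) (N e p : ℕ) :
    coeff q N (N + e + p) (N + e) =
      (q⁻¹ ^ (p * (N + e)) * gauss (q * conj q) (N + e + p) p) •
      (jacobi q N p e * star (O.a q) ^ e * O.b q ^ p * O.D q ^ (N + e)) := by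
  rw [coeff_eq_sum_of_ge hq hQ _ _ _ (by omega), jacobi_eq_sum hq hQ,
    Finset.Nat.sum_antidiagonal_eq_sum_range_succ_mk, Finset.sum_mul, Finset.sum_mul,
    Finset.sum_mul, Finset.smul_sum, Nat.succ_eq_add_one, add_right_comm N e 1,
    Finset.sum_range_add, Finset.sum_eq_zero (s := Finset.range e), add_zero]
  · refine Finset.sum_congr rfl fun m hm => ?_
    obtain ⟨t, rfl⟩ := Nat.exists_eq_add_of_le' (Nat.lt_succ_iff.1 (Finset.mem_range.1 hm))
    dsimp only
    have hQ0 := mul_ne_zero hq (conj_ne_zero_of_ne_zero hq)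
    rw [show t + m + e - m = t + e by omega, show t + m + e + p - (t + e) = m + p by omega,
      c_pow_mul_b_pow_add_mul_D_pow hq, Nat.add_sub_cancel_left, mul_smul_comm,
      star_a_pow_mul_z_pow hq, show t + e + m = t + m + e by omega]
    simp only [smul_mul_assoc, smul_smul, mul_assoc]
    congr 1
    have hw := weight_mul_cbScalar_b hq (t + e) m p
    have hg := gauss_add_mul_qPoch hQ (show p ≤ t + m + e + p by omega) m
    have hs := gauss_symm hQ (p + m) (t + m + e)
    have hP := qPoch_pow_ne_zero hQ p m
    -- Pulling `z^m` out to the left of `a*^e` yields `Q^(em)`, which lowers the apparent degree `t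
    -- + e + m` to the true degree `t + m`.
    have hE : ((q * conj q) ^ ((t + e + m) * m))⁻¹ * (q * conj q) ^ (e * m) =
        ((q * conj q) ^ ((t + m) * m))⁻¹ := by
      rw [show (t + e + m) * m = (t + m) * m + e * m by ring, pow_add]
      field_simp
    rw [show p + m + (t + m + e) = t + m + e + p + m by omega] at hs
    rw [show t + e + m = t + m + e by omega] at hw hE
    rw [jacobiCoeff, show p + e + (t + m) + 1 = t + m + e + p + 1 by omega,
      show m + (t + e) = t + m + e by omega, hs, ← hE]
    rw [mul_div_assoc', mul_div_assoc', eq_div_iff hP]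
    linear_combination (gauss (q * conj q) (t + m) m *
        gauss (q * conj q) (t + m + e + p + m) (p + m) * (q * conj q) ^ (e * m) *
        qPoch ((q * conj q) ^ (p + 1)) (q * conj q) m) * hw
      + (gauss (q * conj q) (t + m) m * q⁻¹ ^ (p * (t + m + e)) * (q * conj q) ^ (e * m) *
        ((-1) ^ m * (q * conj q) ^ (m + m.choose 2) *
          ((q * conj q) ^ ((t + m + e) * m))⁻¹)) * hg
  -- The `e` top terms have `m > N` and vanish, so the degree is `N`, not `N + e`.
  · intro m _
    rw [gauss_eq_zero _ (show N < N + 1 + m by omega), zero_mul, zero_mul, zero_smul]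

/-- The sum is cut at both ends: `k ≤ j` requires `m ≥ p`, and the first binomial requires `m ≤ p +
n`. Hence the degree `n`. -/
theorem coeff_of_le_add_of_ge (hq : q ≠ 0)
    (hQ : ∀ r : ℕ, (q * conj q) ^ (r + 1) ≠ 1) (n e p : ℕ) :
    coeff q (p + n) (n + e) (p + (n + e)) =
      ((conj q)⁻¹ ^ (p * (n + e)) * gauss (q * conj q) (p + n) p) •
      (jacobi q n p e * star (O.a q) ^ e * c q ^ p * O.D q ^ (n + e)) := by
  rw [coeff_eq_sum_of_ge hq hQ _ _ _ (by omega), jacobi_eq_sum hq hQ, sum_antidiagonal_add,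
    Finset.sum_mul, Finset.sum_mul, Finset.sum_mul, Finset.smul_sum, add_right_comm n e 1,
    Finset.sum_range_add, Finset.sum_eq_zero (s := Finset.range e), add_zero]
  · refine Finset.sum_congr rfl fun m hm => ?_
    obtain ⟨t, rfl⟩ := Nat.exists_eq_add_of_le' (Nat.lt_succ_iff.1 (Finset.mem_range.1 hm))
    dsimp only
    have hQ0 := mul_ne_zero hq (conj_ne_zero_of_ne_zero hq)
    rw [show t + m + e - m = t + e by omega, show t + m + e - (t + e) = m by omega,
      c_pow_add_mul_b_pow_mul_D_pow hq, show p + (t + m + e) - (p + (t + m)) = e by omega,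
      mul_smul_comm, star_a_pow_mul_z_pow hq, show t + e + m = t + m + e by omega]
    simp only [smul_mul_assoc, smul_smul, mul_assoc]
    congr 1
    have hw := weight_mul_cbScalar_c hq (t + e) m p
    have hg := gauss_mul_gauss_mul_qPoch hQ t p (p + (t + m + e)) m
    have hs := gauss_symm hQ m (p + (t + m + e))
    have hP := qPoch_pow_ne_zero hQ p m
    have hE : ((q * conj q) ^ ((t + e + m) * m))⁻¹ * (q * conj q) ^ (e * m) =
        ((q * conj q) ^ ((t + m) * m))⁻¹ := by
      rw [show (t + e + m) * m = (t + m) * m + e * m by ring, pow_add]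
      field_simp
    rw [show m + (p + (t + m + e)) = p + (t + m + e) + m by omega] at hs
    rw [show t + e + m = t + m + e by omega] at hw hE
    rw [jacobiCoeff, show p + e + (t + m) + 1 = p + (t + m + e) + 1 by omega,
      show p + m + (t + e) = p + (t + m + e) by omega,
      show t + m + e + (p + m) = p + (t + m + e) + m by omega, hs, ← hE,
      show p + (t + m) = t + m + p by omega]
    rw [mul_div_assoc', mul_div_assoc', eq_div_iff hP]
    linear_combination (gauss (q * conj q) (t + m + p) (p + m) *
        gauss (q * conj q) (p + (t + m + e) + m) m * (q * conj q) ^ (e * m) *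
        qPoch ((q * conj q) ^ (p + 1)) (q * conj q) m) * hw
      + ((conj q)⁻¹ ^ (p * (t + m + e)) * (q * conj q) ^ (e * m) *
        ((-1) ^ m * (q * conj q) ^ (m + m.choose 2) *
          ((q * conj q) ^ ((t + m + e) * m))⁻¹)) * hg
  · intro m _
    rw [gauss_eq_zero _ (show p + n < p + (n + 1 + m) by omega), zero_mul, zero_mul, zero_smul]
  · intro m k h
    simp [gauss_eq_zero (q * conj q) (show n + e + m < m + k by omega)]

/-! ### Normalisation, existence and uniqueness of the matrix -/

theorem map_gauss {K K' : Type*} [Field K] [Field K'] (φ : K →+* K') (Q : K) (n k : ℕ) :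
    φ (gauss Q n k) = gauss (φ Q) n k := by
  induction n generalizing k with
  | zero => cases k <;> simp
  | succ n ih => cases k <;> simp [gauss_succ_succ, ih]

/-- Ensures that the square roots normalising `f` are nonzero and can be cancelled. -/
theorem gauss_pos {Q : ℝ} (hQ : 0 ≤ Q) {n k : ℕ} (h : k ≤ n) : 0 < gauss Q n k := by
  induction n generalizing k with
  | zero => rw [Nat.le_zero.1 h]; simp
  | succ n ih =>
    cases k with
    | zero => simp
    | succ k =>
      rw [gauss_succ_succ]
      have h1 := ih (Nat.le_of_succ_le_succ h)
      rcases (Nat.le_of_succ_le_succ h).eq_or_lt with rfl | h2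
      · rw [gauss_eq_zero Q (Nat.lt_succ_self k)]
        simp
      · have := ih (Nat.succ_le_of_lt h2)
        positivity

theorem norm_sq_pow_ne_one (hq1 : ‖q‖ < 1) (r : ℕ) : (‖q‖ ^ 2) ^ (r + 1) ≠ 1 := by
  rw [← pow_mul]
  exact (pow_lt_one₀ (norm_nonneg q) hq1 (by omega)).ne

theorem mul_conj_pow_ne_one (hq1 : ‖q‖ < 1) (r : ℕ) : (q * conj q) ^ (r + 1) ≠ 1 := by
  rw [← normSq_eq]
  exact_mod_cast norm_sq_pow_ne_one hq1 r

theorem binomC_eq_gauss (hq1 : ‖q‖ < 1) {n m : ℕ} (h : m ≤ n) :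
    binomC q n m = gauss (q * conj q) n m := by
  rw [binomC, qBinom_eq_gauss (norm_sq_pow_ne_one hq1) h, ← normSq_eq]
  exact map_gauss Complex.ofRealHom _ _ _

theorem sqrt_qBinom_ne_zero (hq1 : ‖q‖ < 1) {L : ℕ} (i : Fin (L + 1)) :
    Real.sqrt (qBinom (‖q‖ ^ 2) L i) ≠ 0 := by
  have h : (i : ℕ) ≤ L := Nat.lt_succ_iff.1 i.2
  rw [qBinom_eq_gauss (norm_sq_pow_ne_one hq1) h]
  exact (Real.sqrt_pos.2 (gauss_pos (sq_nonneg _) h)).ne'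

/-- The matrix coefficients of the corepresentation on the span of the `f q L j`. -/
noncomputable def matrixCoeff (q : ℂ) (L : ℕ) : Matrix (Fin (L + 1)) (Fin (L + 1)) (O q) :=
  fun i j => ratio q L i j • coeff q (L - (j : ℕ)) j i

theorem isMatrixCoeff_matrixCoeff (hq : q ≠ 0) (hq1 : ‖q‖ < 1) (L : ℕ) :
    IsMatrixCoeff hq L (matrixCoeff q L) := by
  intro j
  have hj : (j : ℕ) ≤ L := Nat.lt_succ_iff.1 j.2
  rw [f, map_smul, comul_a_pow_mul_b_pow, Nat.sub_add_cancel hj, Finset.sum_range,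
    Finset.smul_sum]
  refine Finset.sum_congr rfl fun i _ => ?_
  rw [f, matrixCoeff, TensorProduct.tmul_smul, ← TensorProduct.smul_tmul', smul_smul, ratio,
    Complex.ofReal_div, div_mul_cancel₀]
  exact_mod_cast sqrt_qBinom_ne_zero hq1 i

theorem IsMatrixCoeff.eq_matrixCoeff (hq : q ≠ 0) (hq1 : ‖q‖ < 1) {L : ℕ}
    {t : Matrix (Fin (L + 1)) (Fin (L + 1)) (O q)} (ht : IsMatrixCoeff hq L t) :
    t = matrixCoeff q L := by
  funext i j
  refine congrFun (eq_of_sum_tmul_eq hq (s := fun i => t i j) (t := fun i => matrixCoeff q L i j)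
    (w := fun i => ((Real.sqrt (qBinom (‖q‖ ^ 2) L i) : ℝ) : ℂ))
    (fun i => by exact_mod_cast sqrt_qBinom_ne_zero hq1 i) ?_) i
  exact (ht j).symm.trans (isMatrixCoeff_matrixCoeff hq hq1 L j)

theorem Dpow_natCast_add (q : ℂ) (n : ℕ) (k : ℤ) :
    Dpow q ((n : ℤ) + k) = O.D q ^ n * Dpow q k := by
  rw [Dpow, zpow_add, zpow_natCast, Units.val_mul, Units.val_pow_eq_pow_val]
  rfl

theorem zpow_neg_mul_eq (x : ℂ) (i p : ℕ) : x ^ (-(p : ℤ) * (i : ℤ)) = x⁻¹ ^ (p * i) := by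
  rw [neg_mul, zpow_neg, inv_pow, ← zpow_natCast, Nat.cast_mul]

end Uq2

open scoped ComplexConjugate in
/-- Here `L = 2l`, the indices `i j : Fin (L + 1)` stand for `l + i` and `l + j`, and `Uq2.wt` gives
back `i` and `j` themselves. Under the hypothesis of each case the natural-number subtractions
below are exact: `L - i - j = -(i + j)` or `i + j - L = i + j`, `L - i = l - i`, `i - j = i - j`. -/
theorem theorem4 (q : ℂ) (hq0 : q ≠ 0) (hq1 : ‖q‖ < 1) (L : ℕ) :
    (∃! t : Matrix (Fin (L + 1)) (Fin (L + 1)) (Uq2.O q), Uq2.IsMatrixCoeff hq0 L t) ∧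
    ∀ t : Matrix (Fin (L + 1)) (Fin (L + 1)) (Uq2.O q), Uq2.IsMatrixCoeff hq0 L t →
      ∀ (i j : Fin (L + 1)) (k : ℤ),
        (Uq2.wt i + Uq2.wt j ≤ 0 → Uq2.wt j ≤ Uq2.wt i →
          t i j * Uq2.Dpow q k =
            (conj q ^ (((j : ℤ) - (i : ℤ)) * (j : ℤ)) * Uq2.ratio q L i j *
              Uq2.binomC q (L - (j : ℕ)) ((i : ℕ) - (j : ℕ))) •
            (Uq2.O.a q ^ (L - (i : ℕ) - (j : ℕ)) * Uq2.c q ^ ((i : ℕ) - (j : ℕ)) *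
              Uq2.jacobi q (j : ℕ) ((i : ℤ) - (j : ℤ)) ((L : ℤ) - (i : ℤ) - (j : ℤ)) *
              Uq2.Dpow q ((j : ℤ) + k))) ∧
        (Uq2.wt i + Uq2.wt j ≤ 0 → Uq2.wt i ≤ Uq2.wt j →
          t i j * Uq2.Dpow q k =
            (q ^ (((i : ℤ) - (j : ℤ)) * (i : ℤ)) * Uq2.ratio q L i j *
              Uq2.binomC q (j : ℕ) ((j : ℕ) - (i : ℕ))) •
            (Uq2.O.a q ^ (L - (i : ℕ) - (j : ℕ)) * Uq2.O.b q ^ ((j : ℕ) - (i : ℕ)) *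
              Uq2.jacobi q (i : ℕ) ((j : ℤ) - (i : ℤ)) ((L : ℤ) - (i : ℤ) - (j : ℤ)) *
              Uq2.Dpow q ((i : ℤ) + k))) ∧
        (0 ≤ Uq2.wt i + Uq2.wt j → Uq2.wt i ≤ Uq2.wt j →
          t i j * Uq2.Dpow q k =
            (q ^ (((i : ℤ) - (j : ℤ)) * (i : ℤ)) * Uq2.ratio q L i j *
              Uq2.binomC q (j : ℕ) ((j : ℕ) - (i : ℕ))) •
            (Uq2.jacobi q (L - (j : ℕ)) ((j : ℤ) - (i : ℤ)) ((i : ℤ) + (j : ℤ) - (L : ℤ)) *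
              star (Uq2.O.a q) ^ ((i : ℕ) + (j : ℕ) - L) * Uq2.O.b q ^ ((j : ℕ) - (i : ℕ)) *
              Uq2.Dpow q ((i : ℤ) + k))) ∧
        (0 ≤ Uq2.wt i + Uq2.wt j → Uq2.wt j ≤ Uq2.wt i →
          t i j * Uq2.Dpow q k =
            (conj q ^ (((j : ℤ) - (i : ℤ)) * (j : ℤ)) * Uq2.ratio q L i j *
              Uq2.binomC q (L - (j : ℕ)) ((i : ℕ) - (j : ℕ))) •
            (Uq2.jacobi q (L - (i : ℕ)) ((i : ℤ) - (j : ℤ)) ((i : ℤ) + (j : ℤ) - (L : ℤ)) *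
              star (Uq2.O.a q) ^ ((i : ℕ) + (j : ℕ) - L) * Uq2.c q ^ ((i : ℕ) - (j : ℕ)) *
              Uq2.Dpow q ((j : ℤ) + k))) := by
  have hQ := Uq2.mul_conj_pow_ne_one hq1
  refine ⟨⟨Uq2.matrixCoeff q L, Uq2.isMatrixCoeff_matrixCoeff hq0 hq1 L,
    fun t ht => Uq2.IsMatrixCoeff.eq_matrixCoeff hq0 hq1 ht⟩, ?_⟩
  intro t ht i j k
  rw [Uq2.IsMatrixCoeff.eq_matrixCoeff hq0 hq1 ht, Uq2.matrixCoeff]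
  have hij : Uq2.wt i + Uq2.wt j ≤ 0 ↔ (i : ℕ) + (j : ℕ) ≤ L := by
    rw [← Nat.cast_le (α := ℚ), Uq2.wt, Uq2.wt, Nat.cast_add]
    constructor <;> intro h <;> linarith
  have hij' : 0 ≤ Uq2.wt i + Uq2.wt j ↔ L ≤ (i : ℕ) + (j : ℕ) := by
    rw [← Nat.cast_le (α := ℚ), Uq2.wt, Uq2.wt, Nat.cast_add]
    constructor <;> intro h <;> linarith
  have hle : ∀ i j : Fin (L + 1), Uq2.wt i ≤ Uq2.wt j ↔ (i : ℕ) ≤ (j : ℕ) := by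
    intro i j
    rw [← Nat.cast_le (α := ℚ), Uq2.wt, Uq2.wt, sub_le_sub_iff_right]
  rw [hij, hij', hle, hle, Uq2.Dpow_natCast_add, Uq2.Dpow_natCast_add,
    Uq2.binomC_eq_gauss hq1 (show (i : ℕ) - j ≤ L - j by omega),
    Uq2.binomC_eq_gauss hq1 (Nat.sub_le _ _)]
  have hi : (i : ℕ) ≤ L := Nat.lt_succ_iff.1 i.2
  have hj : (j : ℕ) ≤ L := Nat.lt_succ_iff.1 j.2
  generalize Uq2.ratio q L i j = ρ
  generalize (i : ℕ) = I at *
  generalize (j : ℕ) = J at *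
  refine ⟨fun h1 h2 => ?_, fun h1 h2 => ?_, fun h1 h2 => ?_, fun h1 h2 => ?_⟩
  -- Here `p = i - j` and `n = L - i - j` as naturals, so all truncated subtractions become exact;
  -- the other cases are parametrised likewise.
  · obtain ⟨p, rfl⟩ := Nat.exists_eq_add_of_le' h2
    obtain ⟨n, rfl⟩ := Nat.exists_eq_add_of_le h1
    rw [show p + J + J + n - J = p + J + n by omega, Uq2.coeff_of_add_le_of_ge hq0 hQ,
      show p + J + J + n - (p + J) - J = n by omega, Nat.add_sub_cancel,
      show (J : ℤ) - (p + J : ℕ) = -(p : ℤ) by push_cast; ring,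
      show ((p + J : ℕ) : ℤ) - J = p by push_cast; ring,
      show ((p + J + J + n : ℕ) : ℤ) - (p + J : ℕ) - J = n by push_cast; ring,
      Uq2.zpow_neg_mul_eq, smul_mul_assoc, smul_mul_assoc, smul_smul]
    simp only [mul_assoc]
    congr 1
    ring
  · obtain ⟨p, rfl⟩ := Nat.exists_eq_add_of_le h2
    obtain ⟨n, rfl⟩ := Nat.exists_eq_add_of_le h1
    rw [show I + (I + p) + n - (I + p) = I + n by omega, Uq2.coeff_of_add_le_of_le hq0 hQ,
      show I + (I + p) + n - I - (I + p) = n by omega, Nat.add_sub_cancel_left,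
      show (I : ℤ) - (I + p : ℕ) = -(p : ℤ) by push_cast; ring,
      show ((I + p : ℕ) : ℤ) - I = p by push_cast; ring,
      show ((I + (I + p) + n : ℕ) : ℤ) - I - (I + p : ℕ) = n by push_cast; ring,
      Uq2.zpow_neg_mul_eq, smul_mul_assoc, smul_mul_assoc, smul_smul]
    simp only [mul_assoc]
    congr 1
    ring
  · obtain ⟨p, rfl⟩ := Nat.exists_eq_add_of_le h2
    -- `N = L - j` is the degree, and `e = i + j - L` is the exponent of `a*`.
    obtain ⟨N, rfl⟩ := Nat.exists_eq_add_of_le' hj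
    obtain ⟨e, rfl⟩ := Nat.exists_eq_add_of_le (show N ≤ I by omega)
    rw [Nat.add_sub_cancel, Uq2.coeff_of_le_add_of_le hq0 hQ, Nat.add_sub_cancel_left,
      show N + e + (N + e + p) - (N + (N + e + p)) = e by omega,
      show ((N + e : ℕ) : ℤ) - (N + e + p : ℕ) = -(p : ℤ) by push_cast; ring,
      show ((N + e + p : ℕ) : ℤ) - (N + e : ℕ) = p by push_cast; ring,
      show ((N + e : ℕ) : ℤ) + (N + e + p : ℕ) - (N + (N + e + p) : ℕ) = e by push_cast; ring,
      Uq2.zpow_neg_mul_eq, smul_mul_assoc, smul_mul_assoc, smul_smul]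
    simp only [mul_assoc]
    congr 1
    ring
  · obtain ⟨p, rfl⟩ := Nat.exists_eq_add_of_le' h2
    obtain ⟨n, rfl⟩ := Nat.exists_eq_add_of_le hi
    obtain ⟨e, rfl⟩ := Nat.exists_eq_add_of_le (show n ≤ J by omega)
    rw [show p + (n + e) + n - (n + e) = p + n by omega, Uq2.coeff_of_le_add_of_ge hq0 hQ,
      Nat.add_sub_cancel, Nat.add_sub_cancel_left,
      show p + (n + e) + (n + e) - (p + (n + e) + n) = e by omega,
      show ((n + e : ℕ) : ℤ) - (p + (n + e) : ℕ) = -(p : ℤ) by push_cast; ring,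
      show ((p + (n + e) : ℕ) : ℤ) - (n + e : ℕ) = p by push_cast; ring,
      show ((p + (n + e) : ℕ) : ℤ) + (n + e : ℕ) - (p + (n + e) + n : ℕ) = e by push_cast; ring,
      Uq2.zpow_neg_mul_eq, smul_mul_assoc, smul_mul_assoc, smul_smul]
    simp only [mul_assoc]
    congr 1
    ring
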